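/- Let $J$ be the space of points $(t,x,u_0,u_1,u_2,\dots)$ with the product topology, where $u_0=u$ and $u_k$ stands for $\partial_x^k u$. A differential function on an open set $V\subseteq J$ is a smooth real function on $V$ of $t$, $x$ and finitely many of the $u_k$. Put $$\mathrm D_x=\partial_x+\sum_k u_{k+1}\partial_{u_k},\qquad \frac{\delta\rho}{\delta u}=\sum_k(-\mathrm D_x)^k\frac{\partial\rho}{\partial u_k},\qquad \bar{\mathrm D}_t=\partial_t+\sum_k(\mathrm D_x^kG)\,\partial_{u_k}.$$ Let $\mathrm W(f^1,\dots,f^k)=\det(\mathrm D_x^{i-1}f^j)_{i,j=1}^k$ be the Wronskian, with $\mathrm W()=1$. Let $\mathrm{DT}(f^1,\dots,f^k)$ be the Darboux operator, that is, the differential operator $\sum_i a_i\mathrm D_x^i$ acting by $g\mapsto \mathrm W(f^1,\dots,f^k,g)/\mathrm W(f^1,\dots,f^k)$, and let $\mathrm{DT}(f^1,\dots,f^k)^\dagger g=\sum_i(-\mathrm D_x)^i(a_i g)$ be its formal adjoint. Let $U\subseteq J$ be open and let $$u_t=G(t,x,u_0,\dots,u_r),\qquad r\ge 2,\quad G_{u_r}\not\equiv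 0,$$ be an evolution equation with $G$ a differential function on $U$. A conserved current on an open $V\subseteq U$ is a pair $(\rho,\sigma)$ of differential functions on $V$ (density and flux) with $\bar{\mathrm D}_t\rho+\mathrm D_x\sigma=0$ on $V$. It is trivial if around each point of $V$ it has the form $(\mathrm D_x\Theta,-\bar{\mathrm D}_t\Theta)$ for some differential function $\Theta$. Conservation laws on $V$ are conserved currents modulo trivial ones; they form a real vector space. Let $p\ge1$, let $\rho^1,\dots,\rho^p$ be differential functions on $U$, and let $\lambda^s=\delta\rho^s/\delta u$ be the corresponding characteristics. Let $U_{\rm reg}$ be the set of points of $U$ at which $\mathrm W(\lambda^1,\dots,\lambda^p)$ and the $p$ Wronskians $\mathrm W(\lambda^1,\dots,\cancel{\lambda^s},\dots,\lambda^p)$, in which $\lambda^s$ is omitted, are all nonzero. **Theorem.** (1) Let $V\subseteq U_{\rm reg}$ be open and nonempty. On $V$ the equation admits $p$ linearly independent conservation laws with densities $\rho^1,\dots,\rho^p$ (and hence with characteristics $\lambda^1,\dots,\lambda^p$) if and only if, on $V$, $$G=\mathrm{DT}(\lambda^1,\dots,\lambda^p)^\dagger H-\sum_{s=1}^p(-1)^{p-s}\,\mathrm{DT}(\lambda^1,\dots,\cancel{\lambda^s},\dots,\lambda^p)^\dagger\left(\frac{\mathrm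 W(\lambda^1,\dots,\cancel{\lambda^s},\dots,\lambda^p)}{\mathrm W(\lambda^1,\dots,\lambda^p)}\,\frac{\partial\rho^s}{\partial t}\right)$$ for some differential function $H$ on $V$. (2) If on every nonempty open subset of $U$ the equation admits $p$ linearly independent conservation laws with densities $\rho^1,\dots,\rho^p$, then $U_{\rm reg}$ is dense in $U$. -/

import Mathlib

open scoped ContDiff

/-- The jet space of the evolution equation: a point is `(t, x, (u₀, u₁, u₂, …))`, where `u_k`
stands for `∂ₓᵏ u`. It carries the product topology. -/
abbrev Jet : Type := ℝ × ℝ × (ℕ → ℝ)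

namespace EvolutionCL

/-- The projection `(t, x, u₀, u₁, …) ↦ (t, x, u₀, …, u_n)`. -/
def trunc (n : ℕ) (z : Jet) : ℝ × ℝ × (Fin (n + 1) → ℝ) :=
  (z.1, z.2.1, fun k => z.2.2 k)

/-- On `U`, the function `f` is a smooth function of `t, x, u₀, …, u_n` only. The values of `f`
outside `U` play no role. -/
def IsDiffFunOfOrderLE (n : ℕ) (U : Set Jet) (f : Jet → ℝ) : Prop :=
  ∃ g : ℝ × ℝ × (Fin (n + 1) → ℝ) → ℝ,
    ContDiffOn ℝ ∞ g (trunc n '' U) ∧ ∀ z ∈ U, f z = g (trunc n z)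

/-- `f` is a differential function on `U`: smooth, with finitely many arguments. -/
def IsDiffFun (U : Set Jet) (f : Jet → ℝ) : Prop :=
  ∃ n, IsDiffFunOfOrderLE n U f

/-- `∂f/∂t`. -/
noncomputable def partialT (f : Jet → ℝ) (z : Jet) : ℝ :=
  deriv (fun y => f (y, z.2.1, z.2.2)) z.1

/-- `∂f/∂x` (with the `u_k` held fixed). -/
noncomputable def partialX (f : Jet → ℝ) (z : Jet) : ℝ :=
  deriv (fun y => f (z.1, y, z.2.2)) z.2.1

/-- `∂f/∂u_k`. -/
noncomputable def partialU (k : ℕ) (f : Jet → ℝ) (z : Jet) : ℝ :=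
  deriv (fun y => f (z.1, z.2.1, Function.update z.2.2 k y)) (z.2.2 k)

/-- The total derivative `D_x = ∂ₓ + ∑ₖ u_{k+1} ∂_{u_k}`. At points of an open set on which `f`
is a differential function, only finitely many terms are nonzero. -/
noncomputable def Dx (f : Jet → ℝ) (z : Jet) : ℝ :=
  partialX f z + ∑ᶠ k : ℕ, z.2.2 (k + 1) * partialU k f z

/-- The total derivative in `t` restricted to the equation `u_t = G`:
`D̄_t = ∂_t + ∑ₖ (D_xᵏ G) ∂_{u_k}`. -/
noncomputable def DtBar (G f : Jet → ℝ) (z : Jet) : ℝ :=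
  partialT f z + ∑ᶠ k : ℕ, (Dx^[k] G) z * partialU k f z

/-- The variational derivative `δρ/δu = ∑ₖ (-D_x)ᵏ (∂ρ/∂u_k)`. -/
noncomputable def varDeriv (ρ : Jet → ℝ) (z : Jet) : ℝ :=
  ∑ᶠ k : ℕ, (-1) ^ k * (Dx^[k] (partialU k ρ)) z

/-- `(ρ, σ)` is a conserved current on `U` of the equation `u_t = G`: both are differential
functions on `U` and `D̄_t ρ + D_x σ = 0` there. -/
def IsConservedCurrent (G : Jet → ℝ) (U : Set Jet) (ρ σ : Jet → ℝ) : Prop :=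
  IsDiffFun U ρ ∧ IsDiffFun U σ ∧ ∀ z ∈ U, DtBar G ρ z + Dx σ z = 0

/-- `(ρ, σ)` is a trivial conserved current on `U`: around each point of `U` it is, on the
equation, a null divergence `(D_x Θ, -D̄_t Θ)`. -/
def IsTrivialCurrent (G : Jet → ℝ) (U : Set Jet) (ρ σ : Jet → ℝ) : Prop :=
  ∀ z ∈ U, ∃ V : Set Jet, IsOpen V ∧ z ∈ V ∧ V ⊆ U ∧ ∃ Θ : Jet → ℝ, IsDiffFun V Θ ∧
    ∀ w ∈ V, ρ w = Dx Θ w ∧ σ w = -DtBar G Θ w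

/-- On `U`, the equation `u_t = G` admits linearly independent conservation laws with densities
`ρ s`: the `ρ s` can be completed by fluxes to conserved currents whose classes modulo trivial
conserved currents are linearly independent over `ℝ`. -/
def AdmitsLinIndepCL {p : ℕ} (G : Jet → ℝ) (U : Set Jet) (ρ : Fin p → Jet → ℝ) : Prop :=
  ∃ σ : Fin p → Jet → ℝ, (∀ s, IsConservedCurrent G U (ρ s) (σ s)) ∧
    ∀ c : Fin p → ℝ,
      IsTrivialCurrent G U (fun z => ∑ s, c s * ρ s z) (fun z => ∑ s, c s * σ s z) → c = 0

/-- The Wronskian `W(f¹, …, fᵏ)` in the total derivative `D_x`; `W() = 1` for `k = 0`. -/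
noncomputable def wronskian {k : ℕ} (f : Fin k → Jet → ℝ) (z : Jet) : ℝ :=
  Matrix.det (Matrix.of fun i j : Fin k => (Dx^[(i : ℕ)] (f j)) z)

/-- The action `∑ᵢ aᵢ D_xⁱ g` of the differential operator with coefficients `a₀, …, a_{m-1}`. -/
noncomputable def opApply {m : ℕ} (a : Fin m → Jet → ℝ) (g : Jet → ℝ) (z : Jet) : ℝ :=
  ∑ i : Fin m, a i z * (Dx^[(i : ℕ)] g) z

/-- The action `∑ᵢ (-D_x)ⁱ (aᵢ g)` of the formal adjoint of that operator. -/
noncomputable def opAdjointApply {m : ℕ} (a : Fin m → Jet → ℝ) (g : Jet → ℝ) (z : Jet) : ℝ :=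
  ∑ i : Fin m, (-1) ^ (i : ℕ) * (Dx^[(i : ℕ)] (fun w => a i w * g w)) z

/-- The coefficient of `D_xⁱ` in the Darboux operator `DT(f¹, …, fᵏ)`, that is, the cofactor of
`D_xⁱ g` in `W(f¹, …, fᵏ, g)` divided by `W(f¹, …, fᵏ)`; see `opApply_darbouxCoeff`. -/
noncomputable def darbouxCoeff {k : ℕ} (f : Fin k → Jet → ℝ) (i : Fin (k + 1)) (z : Jet) : ℝ :=
  (-1) ^ ((i : ℕ) + k) *
    Matrix.det (Matrix.of fun a b : Fin k => (Dx^[((i.succAbove a : Fin (k + 1)) : ℕ)] (f b)) z) /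
      wronskian f z

/-- The Darboux operator acts by `DT(f¹, …, fᵏ) g = W(f¹, …, fᵏ, g) / W(f¹, …, fᵏ)`. -/
theorem opApply_darbouxCoeff {k : ℕ} (f : Fin k → Jet → ℝ) (g : Jet → ℝ) (z : Jet) :
    opApply (darbouxCoeff f) g z =
      wronskian (Fin.snoc (α := fun _ => Jet → ℝ) f g) z / wronskian f z := by
  rw [wronskian, Matrix.det_succ_column _ (Fin.last k), Finset.sum_div, opApply]
  refine Finset.sum_congr rfl fun i _ => ?_
  have h : (Matrix.of fun i j : Fin (k + 1) =>
        (Dx^[(i : ℕ)] (Fin.snoc (α := fun _ => Jet → ℝ) f g j)) z).submatrix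
        i.succAbove (Fin.last k).succAbove =
      Matrix.of fun a b : Fin k => (Dx^[((i.succAbove a : Fin (k + 1)) : ℕ)] (f b)) z := by
    ext a b
    simp
  rw [h]
  simp only [darbouxCoeff, Matrix.of_apply, Fin.snoc_last, Fin.val_last]
  ring

/-- `DT(f¹, …, fᵏ)† g`. -/
noncomputable def darbouxAdjoint {k : ℕ} (f : Fin k → Jet → ℝ) (g : Jet → ℝ) : Jet → ℝ :=
  opAdjointApply (darbouxCoeff f) g

/-- The points of `U` at which `W(λ¹, …, λᵖ)` and all the Wronskians of the tuples with one
`λˢ` omitted are nonzero, where `λˢ = δρˢ/δu` and `p = n + 1`. -/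
def regularSet {n : ℕ} (U : Set Jet) (ρ : Fin (n + 1) → Jet → ℝ) : Set Jet :=
  {z ∈ U | wronskian (fun s => varDeriv (ρ s)) z ≠ 0 ∧
    ∀ s : Fin (n + 1), wronskian (fun j : Fin n => varDeriv (ρ (s.succAbove j))) z ≠ 0}

end EvolutionCL

/-! Work modulo total derivatives. Integration by parts gives `D̄_t ρ ≡ ∂_t ρ + (δρ/δu) G`
(`exists_DtBar_eq`), so `ρˢ` is a conserved density exactly when `λˢ G + ∂_t ρˢ` is a total
derivative. These `p` conditions form an inhomogeneous linear problem for `G`, and part (1)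
describes its solutions.

For an operator `P`, `h · P†g ≡ g · P h` (`opAdj_sub_mem`). The Darboux operator of all the `λ`
kills each `λʳ`, so its adjoint produces homogeneous solutions; variation of parameters shows that
there are no others (`exists_opAdj_dtCoeff_eq`). The Darboux operator with `λˢ` omitted kills every
`λʳ` with `r ≠ s` and sends `λˢ` to a signed quotient of Wronskians, so its adjoint yields a
particular solution (`mul_correction_sub_mem`). Linear independence is automatic on the regular set:
a trivial combination of the currents forces the same combination of the `λˢ` to vanish, against the
nonzero Wronskian.

For part (2), suppose the Wronskian vanishes on an open set. By induction one may shrink to where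
the Wronskian of all but the last characteristic is nonzero; then the last is a combination of the
others with coefficients killed by `D_x`, hence depending on `t` alone (`exists_const_combination`,
`partial_eq_zero_of_Dx_eq_zero`). Such a relation may be differentiated in `t`
(`sum_partialT_mul_varDeriv_eq_zero`), so its coefficients are locally constant. The corresponding
combination of densities has zero variational derivative, and a conserved current with such a
density is trivial (`isTrivialCurrent_of_varDeriv_eq_zero`), a contradiction. This last point rests
on the local exactness `ker δ/δu = im D_x` (`exists_local_potential`). -/

namespace EvolutionCL

/-! ### Wronskians, Darboux operators and adjoints in a differential ring -/

section DifferentialRing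

variable {A : Type*} [CommRing A] [Algebra ℝ A] (D : Derivation ℝ A A)

/-- The Wronskian matrix `(Dⁱ fⱼ)`. -/
def wrMatrix {k : ℕ} (f : Fin k → A) : Matrix (Fin k) (Fin k) A :=
  Matrix.of fun i j => D^[(i : ℕ)] (f j)

/-- The coefficients of the Darboux operator, `w` being the inverse of the Wronskian. -/
def dtCoeff {k : ℕ} (f : Fin k → A) (w : A) (i : Fin (k + 1)) : A :=
  (-1) ^ ((i : ℕ) + k) *
    Matrix.det (Matrix.of fun a b : Fin k => D^[((i.succAbove a : Fin (k + 1)) : ℕ)] (f b)) * w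

/-- The formal adjoint of `∑ aᵢ Dⁱ`. -/
def opAdj {m : ℕ} (a : Fin m → A) (g : A) : A :=
  ∑ i : Fin m, (-1) ^ (i : ℕ) * D^[(i : ℕ)] (a i * g)

/-- Integration by parts, `i` times: each step moves one derivative at the cost of `D (b * D^[i]
h)`. -/
theorem iterate_sub_mem (i : ℕ) (h b : A) :
    h * D^[i] b - (-1) ^ i * (b * D^[i] h) ∈ D.toLinearMap.range := by
  induction i generalizing h b with
  | zero => exact ⟨0, by simp [mul_comm b h]⟩
  | succ i ih =>
    have h1 := ih h (D b)
    have h2 : D b * D^[i] h + b * D^[i + 1] h ∈ D.toLinearMap.range :=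
      ⟨b * D^[i] h, by
        simp only [Derivation.coeFn_coe, Derivation.leibniz, smul_eq_mul,
          Function.iterate_succ_apply']
        ring⟩
    have h3 : (-1 : A) ^ i * (D b * D^[i] h + b * D^[i + 1] h) ∈ D.toLinearMap.range := by
      rcases neg_one_pow_eq_or A i with e | e <;> rw [e]
      · simpa using h2
      · simpa using neg_mem h2
    have := add_mem h1 h3
    convert this using 1
    rw [Function.iterate_succ_apply]
    ring

theorem opAdj_sub_mem {m : ℕ} (a : Fin m → A) (h g : A) :
    h * opAdj D a g - g * ∑ i : Fin m, a i * D^[(i : ℕ)] h ∈ D.toLinearMap.range := by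
  have : h * opAdj D a g - g * ∑ i : Fin m, a i * D^[(i : ℕ)] h =
      ∑ i : Fin m, (-1) ^ (i : ℕ) *
        (h * D^[(i : ℕ)] (a i * g) - (-1) ^ (i : ℕ) * (a i * g * D^[(i : ℕ)] h)) := by
    rw [opAdj, Finset.mul_sum, Finset.mul_sum, ← Finset.sum_sub_distrib]
    refine Finset.sum_congr rfl fun i _ => ?_
    have e : (-1 : A) ^ (i : ℕ) * (-1) ^ (i : ℕ) = 1 := by
      rw [← mul_pow]; simp
    linear_combination (a i * g * D^[(i : ℕ)] h) * e
  rw [this]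
  refine sum_mem fun i _ => ?_
  have h3 := iterate_sub_mem D (i : ℕ) h (a i * g)
  rcases neg_one_pow_eq_or A (i : ℕ) with e | e <;> rw [e] at h3 ⊢
  · simpa using h3
  · simpa using neg_mem h3

/-- Laplace expansion along the last column. -/
theorem sum_dtCoeff_mul {k : ℕ} (f : Fin k → A) (w g : A) :
    ∑ i : Fin (k + 1), dtCoeff D f w i * D^[(i : ℕ)] g =
      (wrMatrix D (Fin.snoc (α := fun _ => A) f g)).det * w := by
  rw [Matrix.det_succ_column _ (Fin.last k), Finset.sum_mul]
  refine Finset.sum_congr rfl fun i _ => ?_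
  have h : (wrMatrix D (Fin.snoc (α := fun _ => A) f g)).submatrix
        i.succAbove (Fin.last k).succAbove =
      Matrix.of fun a b : Fin k => D^[((i.succAbove a : Fin (k + 1)) : ℕ)] (f b) := by
    ext a b
    simp [wrMatrix]
  rw [h]
  simp only [dtCoeff, wrMatrix, Matrix.of_apply, Fin.snoc_last, Fin.val_last]
  ring

theorem dtCoeff_last {k : ℕ} (f : Fin k → A) {w : A} (hw : (wrMatrix D f).det * w = 1) :
    dtCoeff D f w (Fin.last k) = 1 := by
  simp only [dtCoeff, Fin.val_last, ← two_mul, pow_mul, neg_one_sq, one_pow, one_mul]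
  rw [← hw]
  congr 2
  ext a b
  simp [wrMatrix]

/-- The bordered Wronskian has two equal columns. -/
theorem sum_dtCoeff_mul_self {k : ℕ} (f : Fin k → A) (w : A) (j : Fin k) :
    ∑ i : Fin (k + 1), dtCoeff D f w i * D^[(i : ℕ)] (f j) = 0 := by
  rw [sum_dtCoeff_mul, Matrix.det_zero_of_column_eq (i := j.castSucc) (j := Fin.last k)
    (Fin.castSucc_lt_last j).ne, zero_mul]
  intro i
  simp [wrMatrix]

/-- Moving column `s` to the end passes `n - s` columns; in the code, both determinants are expanded
along that column and have the same minors. This evaluates the Darboux operator omitting `f s` at `f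
s`. -/
theorem det_snoc_succAbove {n : ℕ} (f : Fin (n + 1) → A) (s : Fin (n + 1)) :
    (wrMatrix D (Fin.snoc (α := fun _ => A) (fun j => f (s.succAbove j)) (f s))).det =
      (-1) ^ (n - (s : ℕ)) * (wrMatrix D f).det := by
  rw [Matrix.det_succ_column _ (Fin.last n), Matrix.det_succ_column (wrMatrix D f) s,
    Finset.mul_sum]
  refine Finset.sum_congr rfl fun i _ => ?_
  have h : (wrMatrix D (Fin.snoc (α := fun _ => A) (fun j => f (s.succAbove j)) (f s))).submatrix
        i.succAbove (Fin.last n).succAbove =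
      (wrMatrix D f).submatrix i.succAbove s.succAbove := by
    ext a b
    simp [wrMatrix]
  rw [h]
  have hs : (s : ℕ) ≤ n := Nat.lt_succ_iff.mp s.2
  have e : (-1 : A) ^ ((i : ℕ) + n) = (-1) ^ (n - (s : ℕ)) * (-1) ^ ((i : ℕ) + s) := by
    rw [← pow_add]; congr 1; omega
  simp only [wrMatrix, Matrix.of_apply, Fin.snoc_last, Fin.val_last, e]
  ring

/-- A Horner scheme for the adjoint. Indexing by `ℕ` lets the induction shift both sequences by one.
-/
theorem opAdj_eq_of_recursion {m : ℕ} (a : ℕ → A) (g : A) (c : ℕ → A)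
    (h0 : c m = a m * g) (hc : ∀ i < m, c i = a i * g - D (c (i + 1))) :
    c 0 = ∑ i ∈ Finset.range (m + 1), (-1) ^ i * D^[i] (a i * g) := by
  induction m generalizing a c with
  | zero => simp [h0]
  | succ m ih =>
    have := ih (fun i => a (i + 1)) (fun i => c (i + 1)) h0
      (fun i hi => hc (i + 1) (by omega))
    rw [Finset.sum_range_succ', hc 0 (by omega)]
    simp only [zero_add] at this
    rw [zero_add, this, map_sum, sub_eq_add_neg, add_comm, ← Finset.sum_neg_distrib]
    simp only [pow_zero, Function.iterate_zero, id_eq, one_mul]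
    congr 1
    refine Finset.sum_congr rfl fun i _ => ?_
    rw [Function.iterate_succ_apply', pow_succ]
    rcases neg_one_pow_eq_or A i with e | e <;> rw [e] <;> simp

/-- Variation of parameters: if all `λʳ G` are total derivatives, then `G` is in the image of the
adjoint of the Darboux operator. -/
theorem exists_opAdj_dtCoeff_eq {n : ℕ} (l : Fin (n + 1) → A) {w : A}
    (hw : (wrMatrix D l).det * w = 1) (G : A) (Φ : Fin (n + 1) → A)
    (hΦ : ∀ r, l r * G = D (Φ r)) :
    ∃ H, opAdj D (dtCoeff D l w) H = G := by
  set M := wrMatrix D l with hM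
  have hu : IsUnit M.det := IsUnit.of_mul_eq_one w hw
  -- The parameters `b` solve `∑ᵢ bᵢ Dⁱ lᵣ = -Φᵣ`; the last of them will be `H`.
  set b : Fin (n + 1) → A := Matrix.vecMul (-Φ) M⁻¹ with hb
  have hbM : Matrix.vecMul b M = -Φ := by
    rw [hb, Matrix.vecMul_vecMul, Matrix.nonsing_inv_mul _ hu, Matrix.vecMul_one]
  have inj : ∀ v : Fin (n + 1) → A, Matrix.vecMul v M = 0 → v = 0 := by
    intro v hv
    have := congrArg (fun x => Matrix.vecMul x M⁻¹) hv
    simpa [Matrix.vecMul_vecMul, Matrix.mul_nonsing_inv _ hu] using this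
  set a := dtCoeff D l w with ha
  set H := b (Fin.last n) with hH
  refine ⟨H, ?_⟩
  -- Differentiating the system for `b` and eliminating `Dⁿ⁺¹ lᵣ` with the monic Darboux operator
  -- gives a row vector annihilated by `M`. Its vanishing is the recursion `bᵢ₋₁ = aᵢ H - D bᵢ` with
  -- `b₋₁ = G`.
  have key : (fun i : Fin (n + 1) => D (b i) + (if h : 0 < (i : ℕ) then b ⟨i - 1, by omega⟩ else G)
      - a i.castSucc * H) = 0 := by
    apply inj
    ext r
    have h1 : ∑ i : Fin (n + 1), b i * D^[(i : ℕ)] (l r) = - Φ r := by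
      have := congrFun hbM r
      simpa [Matrix.vecMul, dotProduct, hM, wrMatrix] using this
    have h2 : ∑ i : Fin (n + 1), (D (b i) * D^[(i : ℕ)] (l r) + b i * D^[(i : ℕ) + 1] (l r)) =
        - (l r * G) := by
      rw [hΦ, ← map_neg, ← h1, map_sum]
      refine Finset.sum_congr rfl fun i _ => ?_
      rw [Derivation.leibniz, Function.iterate_succ_apply', smul_eq_mul, smul_eq_mul]
      ring
    have h3 := sum_dtCoeff_mul_self D l w r
    rw [Fin.sum_univ_castSucc, ← ha] at h3
    have h4 : a (Fin.last (n + 1)) = 1 := dtCoeff_last D l hw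
    rw [h4, Fin.val_last] at h3
    rw [Finset.sum_add_distrib, Fin.sum_univ_castSucc (f := fun i : Fin (n + 1) =>
      b i * D^[(i : ℕ) + 1] (l r))] at h2
    simp only [Fin.val_last, Fin.val_castSucc] at h2 h3
    have h5 : ∑ i : Fin (n + 1), (if h : 0 < (i : ℕ) then b ⟨i - 1, by omega⟩ else G) *
        D^[(i : ℕ)] (l r) = G * l r + ∑ i : Fin n, b i.castSucc * D^[(i : ℕ) + 1] (l r) := by
      rw [Fin.sum_univ_succ]
      simp [Fin.castSucc, Fin.castAdd, Fin.castLE]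
    simp only [Matrix.vecMul, dotProduct, Pi.zero_apply, hM, wrMatrix, Matrix.of_apply,
      sub_mul, add_mul, Finset.sum_sub_distrib, Finset.sum_add_distrib]
    rw [h5]
    have h6 : ∑ i : Fin (n + 1), a i.castSucc * H * D^[(i : ℕ)] (l r) =
        H * ∑ i : Fin (n + 1), a i.castSucc * D^[(i : ℕ)] (l r) := by
      rw [Finset.mul_sum]
      exact Finset.sum_congr rfl fun i _ => by ring
    rw [h6]
    linear_combination h2 - H * h3
  -- The recursion in Horner form: `cᵢ = bᵢ₋₁` and `c₀ = G`. At the top `cₙ₊₁ = H`, consistent with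
  -- the leading coefficient `1`; the values `0` beyond are never used.
  let a' : ℕ → A := fun i => if h : i < n + 2 then a ⟨i, h⟩ else 0
  let c : ℕ → A := fun i => if h : i = 0 then G else if h : i < n + 2 then b ⟨i - 1, by omega⟩ else 0
  have := opAdj_eq_of_recursion D (m := n + 1) a' H c
    (by
      have h4 : a (Fin.last (n + 1)) = 1 := dtCoeff_last D l hw
      have : a' (n + 1) = 1 := by simpa [a', Fin.last] using h4
      rw [this, one_mul]
      simp [c, hH, Fin.last])
    (by
      intro i hi
      have hk := congrFun key ⟨i, hi⟩
      have e1 : a' i = a (Fin.castSucc ⟨i, hi⟩) := by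
        simp [a', show i < n + 2 by omega]
      have e2 : c (i + 1) = b ⟨i, hi⟩ := by simp [c, hi]
      rw [e1, e2]
      simp only [Pi.zero_apply] at hk
      rcases Nat.eq_zero_or_pos i with h0 | h0
      · subst h0
        simp [c] at hk ⊢
        linear_combination hk
      · have e3 : c i = b ⟨i - 1, by omega⟩ := by
          simp [c, h0.ne', show i < n + 2 by omega]
        rw [dif_pos h0] at hk
        rw [e3]
        linear_combination hk)
  have hc : c 0 = G := by simp [c]
  rw [hc] at this
  rw [this, opAdj, Finset.sum_range]
  refine Finset.sum_congr rfl fun i _ => ?_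
  simp [a', i.2]

/-- If `W(f¹, …, fᵏ)` is invertible and `W(f¹, …, fᵏ, g) = 0`, then `g` is a combination of the
`fʲ` with coefficients in the kernel of `D`. -/
theorem exists_const_combination {k : ℕ} (f : Fin k → A) (g : A) {w : A}
    (hw : (wrMatrix D f).det * w = 1)
    (h0 : (wrMatrix D (Fin.snoc (α := fun _ => A) f g)).det = 0) :
    ∃ c : Fin k → A, (∀ j, D (c j) = 0) ∧ g = ∑ j, c j * f j := by
  set M := wrMatrix D f with hM
  have hu : IsUnit M.det := IsUnit.of_mul_eq_one w hw
  have inj : ∀ v : Fin k → A, M.mulVec v = 0 → v = 0 := by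
    intro v hv
    have := congrArg (M⁻¹.mulVec) hv
    simpa [Matrix.mulVec_mulVec, Matrix.nonsing_inv_mul _ hu] using this
  obtain ⟨c, hc⟩ : ∃ c, M.mulVec c = fun i : Fin k => D^[(i : ℕ)] g :=
    ⟨M⁻¹.mulVec _, by
      rw [Matrix.mulVec_mulVec, Matrix.mul_nonsing_inv _ hu, Matrix.one_mulVec]⟩
  have h1 : ∀ i < k, ∑ j, c j * D^[i] (f j) = D^[i] g := by
    intro i hi
    have := congrFun hc ⟨i, hi⟩
    rw [← this]
    simp only [Matrix.mulVec, dotProduct, hM, wrMatrix, Matrix.of_apply]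
    exact Finset.sum_congr rfl fun _ _ => mul_comm _ _
  -- The monic Darboux operator kills `g` and every `f j`, so their `k`-th derivatives are the same
  -- combination of lower ones.
  have h2 : ∑ j, c j * D^[k] (f j) = D^[k] g := by
    have e : ∀ x, (∑ i : Fin (k + 1), dtCoeff D f w i * D^[(i : ℕ)] x = 0) →
        D^[k] x = - ∑ i : Fin k, dtCoeff D f w i.castSucc * D^[(i : ℕ)] x := by
      intro x hx
      rw [Fin.sum_univ_castSucc, dtCoeff_last D f hw] at hx
      simp only [Fin.val_castSucc, Fin.val_last] at hx
      linear_combination hx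
    rw [e g (by rw [sum_dtCoeff_mul, h0, zero_mul])]
    simp_rw [fun j => e (f j) (sum_dtCoeff_mul_self D f w j)]
    simp_rw [mul_neg, Finset.sum_neg_distrib, Finset.mul_sum]
    rw [Finset.sum_comm]
    congr 1
    refine Finset.sum_congr rfl fun i _ => ?_
    rw [← h1 i i.2, Finset.mul_sum]
    exact Finset.sum_congr rfl fun j _ => by ring
  have h3 : ∀ i ≤ k, ∑ j, c j * D^[i] (f j) = D^[i] g := fun i hi =>
    hi.lt_or_eq.elim (h1 i) fun h => h ▸ h2
  refine ⟨c, ?_, by simpa using (h3 0 (Nat.zero_le _)).symm⟩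
  -- Comparing the derivative of row `i` with row `i + 1` leaves `∑ⱼ D(cⱼ) Dⁱ fⱼ = 0` for all `i <
  -- k`.
  have : (fun j => D (c j)) = 0 := by
    apply inj
    ext i
    have h4 := congrArg D (h1 i i.2)
    rw [map_sum, ← Function.iterate_succ_apply' (⇑D), ← h3 (i + 1) i.2] at h4
    simp only [Derivation.leibniz, smul_eq_mul, ← Function.iterate_succ_apply' (⇑D),
      Finset.sum_add_distrib] at h4
    simp only [Matrix.mulVec, dotProduct, hM, wrMatrix, Matrix.of_apply, Pi.zero_apply]
    linear_combination h4
  exact fun j => congrFun this j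

/-- Constants pass through `D`, so differentiating the relation gives a linear system with the
invertible Wronskian matrix. -/
theorem eq_zero_of_sum_mul_eq_zero {k : ℕ} (f : Fin k → A) {w : A}
    (hw : (wrMatrix D f).det * w = 1) (c : Fin k → A)
    (hc : ∀ j, D (c j) = 0) (h : ∑ j, c j * f j = 0) : c = 0 := by
  have h1 : ∀ i, ∑ j, c j * D^[i] (f j) = 0 := by
    intro i
    induction i with
    | zero => simpa using h
    | succ i ih =>
      have := congrArg D ih
      simpa [Derivation.leibniz, hc, ← Function.iterate_succ_apply' (⇑D)] using this
  have h2 : (wrMatrix D f).mulVec c = 0 := by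
    ext i
    rw [Pi.zero_apply, ← h1 i]
    simp only [Matrix.mulVec, dotProduct, wrMatrix, Matrix.of_apply]
    exact Finset.sum_congr rfl fun _ _ => mul_comm _ _
  have := congrArg ((wrMatrix D f)⁻¹.mulVec) h2
  simpa [Matrix.mulVec_mulVec, Matrix.nonsing_inv_mul _ (IsUnit.of_mul_eq_one w hw)] using this

end DifferentialRing

/-! ### Smooth antiderivatives in a fixed direction -/

section Antiderivative

open MeasureTheory

variable {E : Type} [NormedAddCommGroup E] [NormedSpace ℝ E]

theorem hasFDerivAt_intervalIntegral_param {F : Type} [NormedAddCommGroup F]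
    [NormedSpace ℝ F] {k : E × ℝ → F} (hk : ContDiff ℝ 1 k) (y : E) :
    HasFDerivAt (fun y => ∫ s in (0 : ℝ)..1, k (y, s))
      (∫ s in (0 : ℝ)..1, (fderiv ℝ k (y, s)).comp (ContinuousLinearMap.inl ℝ E ℝ)) y := by
  have hc : Continuous fun p : E × ℝ =>
      (fderiv ℝ k p).comp (ContinuousLinearMap.inl ℝ E ℝ) :=
    (hk.continuous_fderiv one_ne_zero).clm_comp continuous_const
  -- A dominating constant valid for all `x` near `y`, by compactness of `[0, 1]`.
  obtain ⟨C, hC⟩ : ∃ C, ∀ᶠ x in nhds y, ∀ s ∈ Set.Icc (0 : ℝ) 1,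
      ‖(fderiv ℝ k (x, s)).comp (ContinuousLinearMap.inl ℝ E ℝ)‖ ≤ C := by
    have hK : IsCompact (Set.Icc (0 : ℝ) 1) := isCompact_Icc
    obtain ⟨C, hC⟩ := hK.exists_bound_of_continuousOn
      (f := fun s => (fderiv ℝ k (y, s)).comp (ContinuousLinearMap.inl ℝ E ℝ))
      (hc.comp (by fun_prop : Continuous fun s : ℝ => (y, s))).continuousOn
    refine ⟨C + 1, ?_⟩
    refine hK.eventually_forall_of_forall_eventually fun s hs => ?_
    have : ∀ᶠ p : E × ℝ in nhds (y, s),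
        ‖(fderiv ℝ k p).comp (ContinuousLinearMap.inl ℝ E ℝ)‖ < C + 1 :=
      (hc.norm.tendsto (y, s)).eventually (gt_mem_nhds (by linarith [hC s hs]))
    filter_upwards [this] with p hp using hp.le
  obtain ⟨S, hS, hSC⟩ := hC.exists_mem
  refine intervalIntegral.hasFDerivAt_integral_of_dominated_of_fderiv_le
    (F := fun y s => k (y, s))
    (F' := fun y s => (fderiv ℝ k (y, s)).comp (ContinuousLinearMap.inl ℝ E ℝ))
    (bound := fun _ => C) hS ?_ ?_ ?_ ?_ ?_ ?_
  · exact Filter.Eventually.of_forall fun x =>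
      (hk.continuous.comp (by fun_prop : Continuous fun s : ℝ => (x, s))).aestronglyMeasurable
  · exact (hk.continuous.comp
      (by fun_prop : Continuous fun s : ℝ => (y, s))).intervalIntegrable _ _
  · exact (hc.comp (by fun_prop : Continuous fun s : ℝ => (y, s))).aestronglyMeasurable
  · refine Filter.Eventually.of_forall fun s hs x hx => hSC x hx s ?_
    rw [Set.uIoc_of_le zero_le_one] at hs
    exact Set.Ioc_subset_Icc_self hs
  · exact intervalIntegrable_const
  · refine Filter.Eventually.of_forall fun s _ x _ => ?_
    have h1 : HasFDerivAt k (fderiv ℝ k (x, s)) (x, s) :=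
      (hk.differentiable one_ne_zero _).hasFDerivAt
    exact h1.comp x (hasFDerivAt_prodMk_left x s)

/-- The derivative is a parameter integral of the same kind with values in another space, so the
target `F` must vary in the induction. -/
theorem contDiff_nat_intervalIntegral_param (n : ℕ) :
    ∀ {F : Type} [NormedAddCommGroup F] [NormedSpace ℝ F] [CompleteSpace F] {k : E × ℝ → F},
      ContDiff ℝ ∞ k → ContDiff ℝ n (fun y => ∫ s in (0 : ℝ)..1, k (y, s)) := by
  induction n with
  | zero =>
    intro F _ _ _ k hk
    have : Continuous fun y => ∫ s in (0 : ℝ)..1, k (y, s) :=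
      continuous_iff_continuousAt.mpr fun y =>
        (hasFDerivAt_intervalIntegral_param (hk.of_le (by simp)) y).continuousAt
    exact contDiff_zero.mpr this
  | succ n ih =>
    intro F _ _ _ k hk
    rw [show ((n + 1 : ℕ) : WithTop ℕ∞) = (n : WithTop ℕ∞) + 1 by simp,
      contDiff_succ_iff_hasFDerivAt]
    refine ⟨_, ?_, fun y => hasFDerivAt_intervalIntegral_param (hk.of_le (by simp)) y⟩
    exact ih (k := fun p => (fderiv ℝ k p).comp (ContinuousLinearMap.inl ℝ E ℝ))
      ((hk.fderiv_right (m := ∞) (by simp)).clm_comp contDiff_const)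

theorem contDiff_intervalIntegral_param {F : Type} [NormedAddCommGroup F] [NormedSpace ℝ F]
    [CompleteSpace F] {k : E × ℝ → F} (hk : ContDiff ℝ ∞ k) :
    ContDiff ℝ ∞ (fun y => ∫ s in (0 : ℝ)..1, k (y, s)) :=
  contDiff_infty.mpr fun n => contDiff_nat_intervalIntegral_param n hk

/-- A smooth function has a smooth antiderivative in the direction `e`. -/
theorem exists_contDiff_antiderivative {g : E → ℝ} (hg : ContDiff ℝ ∞ g) (l : E →L[ℝ] ℝ) (e : E)
    (he : l e = 1) : ∃ F : E → ℝ, ContDiff ℝ ∞ F ∧ ∀ y, fderiv ℝ F y e = g y := by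
  have hk : ContDiff ℝ ∞ (fun p : E × ℝ => g (p.1 - ((1 - p.2) * l p.1) • e)) := by
    have := l.contDiff (n := ∞)
    fun_prop
  -- The integral of `g` along the line through `y` in direction `e`, from the hyperplane `l = 0` to
  -- `y`, rescaled to `[0, 1]` so that its limits are fixed.
  refine ⟨fun y => l y * ∫ s in (0 : ℝ)..1, g (y - ((1 - s) * l y) • e), ?_, fun y => ?_⟩
  · exact l.contDiff.mul (contDiff_intervalIntegral_param hk)
  set F : E → ℝ := fun y => l y * ∫ s in (0 : ℝ)..1, g (y - ((1 - s) * l y) • e) with hF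
  have hFs : ContDiff ℝ ∞ F := l.contDiff.mul (contDiff_intervalIntegral_param hk)
  have h1 : ∀ s : ℝ, F (y + s • e) = ∫ τ in (0 : ℝ)..(l y + s), g (y - l y • e + τ • e) := by
    intro s
    have hl : l (y + s • e) = l y + s := by simp [he]
    have := intervalIntegral.mul_integral_comp_mul_right
      (f := fun τ => g (y - l y • e + τ • e)) (a := 0) (b := 1) (l y + s)
    simp only [zero_mul, one_mul] at this
    rw [← this, hF]
    simp only [hl]
    congr 1
    refine intervalIntegral.integral_congr fun τ _ => ?_
    congr 1
    module
  have h2 : HasDerivAt (fun s : ℝ => F (y + s • e)) (g y) 0 := by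
    simp_rw [h1]
    have hc : Continuous fun τ : ℝ => g (y - l y • e + τ • e) :=
      hg.continuous.comp (by fun_prop)
    have h3 : HasDerivAt (fun u : ℝ => ∫ τ in (0 : ℝ)..u, g (y - l y • e + τ • e))
        (g (y - l y • e + (l y + 0) • e)) (l y + 0) :=
      intervalIntegral.integral_hasDerivAt_right (hc.intervalIntegrable _ _)
        hc.aestronglyMeasurable.stronglyMeasurableAtFilter hc.continuousAt
    have h4 := h3.comp_const_add (l y) 0
    simpa using h4
  have h5 : HasDerivAt (fun s : ℝ => F (y + s • e)) (fderiv ℝ F y e) 0 := by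
    have h6 : HasFDerivAt F (fderiv ℝ F y) (y + (0 : ℝ) • e) := by
      rw [zero_smul, add_zero]
      exact (hFs.differentiable (by simp) y).hasFDerivAt
    have h7 : HasDerivAt (fun s : ℝ => y + s • e) e 0 := by
      simpa using ((hasDerivAt_id (0 : ℝ)).smul_const e).const_add y
    exact h6.comp_hasDerivAt 0 h7
  exact h5.unique h2

/-- Multiplication by a bump function supported in `O` globalizes the germ, since antiderivatives
are constructed for globally smooth functions. -/
theorem exists_contDiff_eventuallyEq [FiniteDimensional ℝ E] {g : E → ℝ} {O : Set E}
    (hO : IsOpen O) (hg : ContDiffOn ℝ ∞ g O) {y : E} (hy : y ∈ O) :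
    ∃ g' : E → ℝ, ContDiff ℝ ∞ g' ∧ g' =ᶠ[nhds y] g := by
  obtain ⟨ε, hε, hb⟩ := Metric.nhds_basis_closedBall.mem_iff.mp (hO.mem_nhds hy)
  let b : ContDiffBump y := ⟨ε / 2, ε, by positivity, by linarith⟩
  refine ⟨fun x => b x * g x, ?_, ?_⟩
  · rw [contDiff_iff_contDiffAt]
    intro x
    by_cases hx : x ∈ O
    · exact b.contDiff.contDiffAt.mul (hg.contDiffAt (hO.mem_nhds hx))
    · have : x ∉ tsupport b := by
        rw [b.tsupport_eq]
        exact fun h => hx (hb h)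
      have h0 : (fun x => b x * g x) =ᶠ[nhds x] fun _ => 0 := by
        filter_upwards [notMem_tsupport_iff_eventuallyEq.mp this] with z hz
        simp [hz]
      exact contDiffAt_const.congr_of_eventuallyEq h0
  · filter_upwards [b.eventuallyEq_one] with z hz
    simp [hz]

end Antiderivative

/-! ### Differential calculus on the jet space -/

section Calculus

/-- The unit vector in the direction of `t`. -/
def eT : Jet := (1, 0, 0)

/-- The unit vector in the direction of `x`. -/
def eX : Jet := (0, 1, 0)

/-- The unit vector in the direction of `u_k`. -/
def eU (k : ℕ) : Jet := (0, 0, Pi.single k 1)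

/-- `trunc n` as a continuous linear map. -/
def truncL (n : ℕ) : Jet →L[ℝ] ℝ × ℝ × (Fin (n + 1) → ℝ) where
  toFun := trunc n
  map_add' _ _ := rfl
  map_smul' _ _ := rfl
  cont := by unfold trunc; fun_prop

theorem trunc_add_smul (n : ℕ) (z v : Jet) (s : ℝ) :
    trunc n (z + s • v) = trunc n z + s • trunc n v := rfl

theorem continuous_trunc (n : ℕ) : Continuous (trunc n) := (truncL n).continuous

/-- A section through `z` fills in the missing coordinates from `z`. Openness makes smoothness on
`trunc n '' V` yield genuine derivatives. -/
theorem isOpenMap_trunc (n : ℕ) : IsOpenMap (trunc n) := by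
  refine IsOpenMap.of_sections fun z => ⟨fun y => (y.1, y.2.1, fun k =>
    if h : k < n + 1 then y.2.2 ⟨k, h⟩ else z.2.2 k), ?_, ?_, ?_⟩
  · refine Continuous.continuousAt ?_
    refine continuous_fst.prodMk (continuous_snd.fst.prodMk (continuous_pi fun k => ?_))
    by_cases h : k < n + 1
    · simp only [h, dif_pos]; fun_prop
    · simp only [h, dif_neg, not_false_eq_true]; fun_prop
  · refine Prod.ext rfl (Prod.ext rfl (funext fun k => ?_))
    by_cases h : k < n + 1 <;> simp [trunc, h]
  · intro y
    refine Prod.ext rfl (Prod.ext rfl (funext fun k => ?_))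
    simp [trunc, Nat.not_lt.mpr (Nat.lt_succ_iff.mp k.2)]

theorem continuous_add_smul (z v : Jet) : Continuous fun s : ℝ => z + s • v := by fun_prop

theorem eventually_mem_line {V : Set Jet} (hV : IsOpen V) {z : Jet} (hz : z ∈ V) (v : Jet) :
    ∀ᶠ s : ℝ in nhds 0, z + s • v ∈ V :=
  (continuous_add_smul z v).continuousAt.eventually_mem (hV.mem_nhds (by simpa using hz))

theorem lineDeriv_congr_on {V : Set Jet} (hV : IsOpen V) {f f' : Jet → ℝ}
    (h : ∀ z ∈ V, f z = f' z) {z : Jet} (hz : z ∈ V) (v : Jet) :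
    lineDeriv ℝ f z v = lineDeriv ℝ f' z v := by
  refine Filter.EventuallyEq.deriv_eq ?_
  filter_upwards [eventually_mem_line hV hz v] with s hs using h _ hs

theorem hasLineDerivAt_congr_on {V : Set Jet} (hV : IsOpen V) {f f' : Jet → ℝ} {d : ℝ}
    (h : ∀ z ∈ V, f z = f' z) {z : Jet} (hz : z ∈ V) {v : Jet} (hd : HasLineDerivAt ℝ f' d z v) :
    HasLineDerivAt ℝ f d z v := by
  refine HasDerivAt.congr_of_eventuallyEq hd ?_
  filter_upwards [eventually_mem_line hV hz v] with s hs using h _ hs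

theorem hasDerivAt_trunc_line (n : ℕ) (z v : Jet) :
    HasDerivAt (fun s : ℝ => trunc n (z + s • v)) (trunc n v) 0 := by
  simp_rw [trunc_add_smul]
  simpa using ((hasDerivAt_id (0 : ℝ)).smul_const (trunc n v)).const_add (trunc n z)

/-- The jet space is not normed, so derivatives there are taken along lines; this reduces them to a
Fréchet derivative in finite dimension. -/
theorem hasLineDerivAt_of_eq {n : ℕ} {V : Set Jet} (hV : IsOpen V) {f : Jet → ℝ}
    {g : ℝ × ℝ × (Fin (n + 1) → ℝ) → ℝ} (hg : ContDiffOn ℝ ∞ g (trunc n '' V))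
    (hfg : ∀ z ∈ V, f z = g (trunc n z)) {z : Jet} (hz : z ∈ V) (v : Jet) :
    HasLineDerivAt ℝ f (fderiv ℝ g (trunc n z) (trunc n v)) z v := by
  refine hasLineDerivAt_congr_on hV hfg hz ?_
  have h1 : HasFDerivAt g (fderiv ℝ g (trunc n z)) (trunc n (z + (0 : ℝ) • v)) := by
    rw [zero_smul, add_zero]
    exact ((hg.contDiffAt ((isOpenMap_trunc n _ hV).mem_nhds
      (Set.mem_image_of_mem _ hz))).differentiableAt (by simp)).hasFDerivAt
  exact h1.comp_hasDerivAt 0 (hasDerivAt_trunc_line n z v)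

theorem IsDiffFun.hasLineDerivAt {V : Set Jet} (hV : IsOpen V) {f : Jet → ℝ}
    (hf : IsDiffFun V f) {z : Jet} (hz : z ∈ V) (v : Jet) :
    HasLineDerivAt ℝ f (lineDeriv ℝ f z v) z v := by
  obtain ⟨n, g, hg, hfg⟩ := hf
  have := hasLineDerivAt_of_eq hV hg hfg hz v
  rwa [this.lineDeriv]

theorem IsDiffFunOfOrderLE.mono_set {n : ℕ} {V W : Set Jet} (h : W ⊆ V) {f : Jet → ℝ}
    (hf : IsDiffFunOfOrderLE n V f) : IsDiffFunOfOrderLE n W f := by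
  obtain ⟨g, hg, hfg⟩ := hf
  exact ⟨g, hg.mono (Set.image_mono h), fun z hz => hfg z (h hz)⟩

theorem IsDiffFun.mono_set {V W : Set Jet} (h : W ⊆ V) {f : Jet → ℝ}
    (hf : IsDiffFun V f) : IsDiffFun W f :=
  hf.imp fun _ => IsDiffFunOfOrderLE.mono_set h

theorem IsDiffFun.congr {V : Set Jet} {f f' : Jet → ℝ} (hf : IsDiffFun V f)
    (h : ∀ z ∈ V, f' z = f z) : IsDiffFun V f' := by
  obtain ⟨n, g, hg, hfg⟩ := hf
  exact ⟨n, g, hg, fun z hz => (h z hz).trans (hfg z hz)⟩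

theorem IsDiffFunOfOrderLE.mono_order {n m : ℕ} (h : n ≤ m) {V : Set Jet} {f : Jet → ℝ}
    (hf : IsDiffFunOfOrderLE n V f) : IsDiffFunOfOrderLE m V f := by
  obtain ⟨g, hg, hfg⟩ := hf
  refine ⟨fun y => g (y.1, y.2.1, fun k => y.2.2 (Fin.castLE (by omega) k)), ?_, hfg⟩
  refine hg.comp (t := trunc n '' V)
    (f := fun y : ℝ × ℝ × (Fin (m + 1) → ℝ) => (y.1, y.2.1, fun k => y.2.2 (Fin.castLE (by omega) k)))
    (by fun_prop) ?_
  rintro _ ⟨z, hz, rfl⟩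
  exact ⟨z, hz, rfl⟩

theorem IsDiffFun.comp₂ {V : Set Jet} {f₁ f₂ : Jet → ℝ} (h₁ : IsDiffFun V f₁)
    (h₂ : IsDiffFun V f₂) {φ : ℝ × ℝ → ℝ} (hφ : ContDiff ℝ ∞ φ) :
    IsDiffFun V (fun z => φ (f₁ z, f₂ z)) := by
  obtain ⟨n₁, h₁⟩ := h₁
  obtain ⟨n₂, h₂⟩ := h₂
  obtain ⟨g₁, hg₁, e₁⟩ := h₁.mono_order (le_max_left n₁ n₂)
  obtain ⟨g₂, hg₂, e₂⟩ := h₂.mono_order (le_max_right n₁ n₂)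
  refine ⟨_, fun y => φ (g₁ y, g₂ y), hφ.comp_contDiffOn (hg₁.prodMk hg₂), fun z hz => ?_⟩
  simp only [e₁ z hz, e₂ z hz]

theorem IsDiffFun.add {V : Set Jet} {f₁ f₂ : Jet → ℝ} (h₁ : IsDiffFun V f₁)
    (h₂ : IsDiffFun V f₂) : IsDiffFun V (fun z => f₁ z + f₂ z) :=
  h₁.comp₂ h₂ (φ := fun p => p.1 + p.2) (by fun_prop)

theorem IsDiffFun.mul {V : Set Jet} {f₁ f₂ : Jet → ℝ} (h₁ : IsDiffFun V f₁)
    (h₂ : IsDiffFun V f₂) : IsDiffFun V (fun z => f₁ z * f₂ z) :=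
  h₁.comp₂ h₂ (φ := fun p => p.1 * p.2) (by fun_prop)

theorem isDiffFun_const (V : Set Jet) (c : ℝ) : IsDiffFun V (fun _ => c) :=
  ⟨0, fun _ => c, contDiffOn_const, fun _ _ => rfl⟩

theorem IsDiffFun.neg {V : Set Jet} {f : Jet → ℝ} (h : IsDiffFun V f) :
    IsDiffFun V (fun z => -f z) :=
  ((isDiffFun_const V (-1)).mul h).congr fun _ _ => by ring

theorem IsDiffFun.sub {V : Set Jet} {f₁ f₂ : Jet → ℝ} (h₁ : IsDiffFun V f₁)
    (h₂ : IsDiffFun V f₂) : IsDiffFun V (fun z => f₁ z - f₂ z) :=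
  (h₁.add h₂.neg).congr fun _ _ => sub_eq_add_neg _ _

theorem IsDiffFun.inv {V : Set Jet} {f : Jet → ℝ} (h : IsDiffFun V f) (h0 : ∀ z ∈ V, f z ≠ 0) :
    IsDiffFun V (fun z => (f z)⁻¹) := by
  obtain ⟨n, g, hg, hfg⟩ := h
  refine ⟨n, fun y => (g y)⁻¹, hg.inv ?_, fun z hz => by simp only [hfg z hz]⟩
  rintro _ ⟨z, hz, rfl⟩
  rw [← hfg z hz]
  exact h0 z hz

theorem IsDiffFun.sum {ι : Type*} {V : Set Jet} (s : Finset ι) {f : ι → Jet → ℝ}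
    (h : ∀ i, IsDiffFun V (f i)) : IsDiffFun V (fun z => ∑ i ∈ s, f i z) := by
  classical
  induction s using Finset.induction_on with
  | empty => simpa using isDiffFun_const V 0
  | insert i s hi ih => simpa [Finset.sum_insert hi] using (h i).add ih

theorem isDiffFun_coordU (V : Set Jet) (k : ℕ) : IsDiffFun V (fun z => z.2.2 k) :=
  ⟨k, fun y => y.2.2 (Fin.last k), by fun_prop, fun _ _ => rfl⟩

theorem IsDiffFun.lineDeriv_const {V : Set Jet} (hV : IsOpen V) {f : Jet → ℝ} (hf : IsDiffFun V f)
    (v : Jet) : IsDiffFun V (fun z => lineDeriv ℝ f z v) := by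
  obtain ⟨n, g, hg, hfg⟩ := hf
  refine ⟨n, fun y => fderiv ℝ g y (trunc n v), ?_, fun z hz =>
    (hasLineDerivAt_of_eq hV hg hfg hz v).lineDeriv⟩
  exact (hg.fderiv_of_isOpen (m := ∞) (isOpenMap_trunc n _ hV) (by simp)).clm_apply contDiffOn_const

theorem partialT_eq (f : Jet → ℝ) (z : Jet) : partialT f z = lineDeriv ℝ f z eT := by
  have := deriv_comp_const_add (fun y => f (y, z.2.1, z.2.2)) z.1 0
  rw [add_zero] at this
  rw [partialT, ← this, lineDeriv]
  congr 1
  ext s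
  congr 1
  refine Prod.ext ?_ (Prod.ext ?_ ?_) <;> simp [eT]

theorem partialX_eq (f : Jet → ℝ) (z : Jet) : partialX f z = lineDeriv ℝ f z eX := by
  have := deriv_comp_const_add (fun y => f (z.1, y, z.2.2)) z.2.1 0
  rw [add_zero] at this
  rw [partialX, ← this, lineDeriv]
  congr 1
  ext s
  congr 1
  refine Prod.ext ?_ (Prod.ext ?_ ?_) <;> simp [eX]

theorem partialU_eq (k : ℕ) (f : Jet → ℝ) (z : Jet) :
    partialU k f z = lineDeriv ℝ f z (eU k) := by
  have := deriv_comp_const_add (fun y => f (z.1, z.2.1, Function.update z.2.2 k y)) (z.2.2 k) 0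
  rw [add_zero] at this
  rw [partialU, ← this, lineDeriv]
  congr 1
  ext s
  congr 1
  refine Prod.ext ?_ (Prod.ext ?_ (funext fun j => ?_))
  · simp [eU]
  · simp [eU]
  · by_cases h : j = k
    · subst h; simp [eU]
    · simp [eU, h]

theorem lineDeriv_eq_sum {V : Set Jet} (hV : IsOpen V) {f : Jet → ℝ} {n : ℕ}
    (hf : IsDiffFunOfOrderLE n V f) {z : Jet} (hz : z ∈ V) (v : Jet) :
    lineDeriv ℝ f z v = v.1 * partialT f z + v.2.1 * partialX f z +
      ∑ k ∈ Finset.range (n + 1), v.2.2 k * partialU k f z := by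
  obtain ⟨g, hg, hfg⟩ := hf
  have h := fun v => (hasLineDerivAt_of_eq hV hg hfg hz v).lineDeriv
  simp_rw [partialT_eq, partialX_eq, partialU_eq, h]
  have hv : trunc n v = v.1 • trunc n eT + v.2.1 • trunc n eX +
      ∑ k : Fin (n + 1), v.2.2 k • trunc n (eU k) := by
    refine Prod.ext ?_ (Prod.ext ?_ (funext fun j => ?_))
    · simp [trunc, eT, eX, eU, Prod.fst_sum]
    · simp [trunc, eT, eX, eU, Prod.fst_sum, Prod.snd_sum]
    · simp [trunc, eT, eX, eU, Prod.snd_sum, Finset.sum_apply, Pi.single_apply, Fin.val_inj]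
  rw [hv, map_add, map_add, map_sum, Finset.sum_range]
  simp

theorem IsDiffFunOfOrderLE.partialU_eq_zero {V : Set Jet} (hV : IsOpen V) {f : Jet → ℝ} {n k : ℕ}
    (hf : IsDiffFunOfOrderLE n V f) (hk : n < k) {z : Jet} (hz : z ∈ V) : partialU k f z = 0 := by
  obtain ⟨g, hg, hfg⟩ := hf
  rw [partialU_eq, (hasLineDerivAt_of_eq hV hg hfg hz (eU k)).lineDeriv]
  have : trunc n (eU k) = 0 := by
    refine Prod.ext rfl (Prod.ext rfl (funext fun j => ?_))
    have : (j : ℕ) ≠ k := by omega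
    simp [trunc, eU, this]
  rw [this, map_zero]

theorem lineDeriv_eq_finsum {V : Set Jet} (hV : IsOpen V) {f : Jet → ℝ}
    (hf : IsDiffFun V f) {z : Jet} (hz : z ∈ V) (v : Jet) :
    lineDeriv ℝ f z v = v.1 * partialT f z + v.2.1 * partialX f z +
      ∑ᶠ k : ℕ, v.2.2 k * partialU k f z := by
  obtain ⟨n, hf⟩ := hf
  rw [lineDeriv_eq_sum hV hf hz, finsum_eq_sum_of_support_subset]
  intro k hk
  by_contra h
  refine hk ?_
  simp only [Finset.coe_range, Set.mem_Iio, not_lt] at h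
  simp [hf.partialU_eq_zero hV (show n < k by omega) hz]

/-- The vector field `D_x` on the jet space. -/
def fieldX (z : Jet) : Jet := (0, 1, fun k => z.2.2 (k + 1))

/-- The vector field `D̄_t` on the jet space. -/
noncomputable def fieldT (G : Jet → ℝ) (z : Jet) : Jet := (1, 0, fun k => (Dx^[k] G) z)

theorem Dx_eq {V : Set Jet} (hV : IsOpen V) {f : Jet → ℝ} (hf : IsDiffFun V f) {z : Jet}
    (hz : z ∈ V) : Dx f z = lineDeriv ℝ f z (fieldX z) := by
  rw [lineDeriv_eq_finsum hV hf hz]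
  simp [Dx, fieldX]

theorem DtBar_eq {V : Set Jet} (hV : IsOpen V) (G : Jet → ℝ) {f : Jet → ℝ} (hf : IsDiffFun V f)
    {z : Jet} (hz : z ∈ V) : DtBar G f z = lineDeriv ℝ f z (fieldT G z) := by
  rw [lineDeriv_eq_finsum hV hf hz]
  simp [DtBar, fieldT]

theorem IsDiffFun.partialT {V : Set Jet} (hV : IsOpen V) {f : Jet → ℝ} (hf : IsDiffFun V f) :
    IsDiffFun V (partialT f) :=
  (hf.lineDeriv_const hV eT).congr fun z _ => partialT_eq f z

theorem IsDiffFun.partialX {V : Set Jet} (hV : IsOpen V) {f : Jet → ℝ} (hf : IsDiffFun V f) :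
    IsDiffFun V (partialX f) :=
  (hf.lineDeriv_const hV eX).congr fun z _ => partialX_eq f z

theorem IsDiffFun.partialU {V : Set Jet} (hV : IsOpen V) {f : Jet → ℝ} (hf : IsDiffFun V f)
    (k : ℕ) : IsDiffFun V (partialU k f) :=
  (hf.lineDeriv_const hV (eU k)).congr fun z _ => partialU_eq k f z

theorem IsDiffFun.Dx {V : Set Jet} (hV : IsOpen V) {f : Jet → ℝ} (hf : IsDiffFun V f) :
    IsDiffFun V (Dx f) := by
  have hf' := hf
  obtain ⟨n, hn⟩ := hf
  refine ((hf'.partialX hV).add (IsDiffFun.sum (Finset.range (n + 1)) fun k =>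
    (isDiffFun_coordU V (k + 1)).mul (hf'.partialU hV k))).congr fun z hz => ?_
  rw [Dx_eq hV hf' hz, lineDeriv_eq_sum hV hn hz]
  simp [fieldX]

theorem IsDiffFun.iterate_Dx {V : Set Jet} (hV : IsOpen V) {f : Jet → ℝ} (hf : IsDiffFun V f)
    (k : ℕ) : IsDiffFun V (EvolutionCL.Dx^[k] f) := by
  induction k with
  | zero => exact hf
  | succ k ih => rw [Function.iterate_succ_apply']; exact ih.Dx hV

theorem IsDiffFun.DtBar {V : Set Jet} (hV : IsOpen V) {G f : Jet → ℝ} (hG : IsDiffFun V G)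
    (hf : IsDiffFun V f) : IsDiffFun V (DtBar G f) := by
  have hf' := hf
  obtain ⟨n, hn⟩ := hf
  refine ((hf'.partialT hV).add (IsDiffFun.sum (Finset.range (n + 1)) fun k =>
    (hG.iterate_Dx hV k).mul (hf'.partialU hV k))).congr fun z hz => ?_
  rw [DtBar_eq hV G hf' hz, lineDeriv_eq_sum hV hn hz]
  simp [fieldT]

theorem lineDeriv_add_on {V : Set Jet} (hV : IsOpen V) {f₁ f₂ : Jet → ℝ} (h₁ : IsDiffFun V f₁)
    (h₂ : IsDiffFun V f₂) {z : Jet} (hz : z ∈ V) (v : Jet) :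
    lineDeriv ℝ (fun z => f₁ z + f₂ z) z v = lineDeriv ℝ f₁ z v + lineDeriv ℝ f₂ z v :=
  HasLineDerivAt.lineDeriv (HasDerivAt.add (h₁.hasLineDerivAt hV hz v) (h₂.hasLineDerivAt hV hz v))

theorem lineDeriv_mul_on {V : Set Jet} (hV : IsOpen V) {f₁ f₂ : Jet → ℝ} (h₁ : IsDiffFun V f₁)
    (h₂ : IsDiffFun V f₂) {z : Jet} (hz : z ∈ V) (v : Jet) :
    lineDeriv ℝ (fun z => f₁ z * f₂ z) z v =
      f₁ z * lineDeriv ℝ f₂ z v + f₂ z * lineDeriv ℝ f₁ z v := by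
  have := HasDerivAt.mul (h₁.hasLineDerivAt hV hz v) (h₂.hasLineDerivAt hV hz v)
  simp only [zero_smul, add_zero] at this
  refine (HasDerivAt.deriv this).trans ?_
  ring

theorem lineDeriv_const_on (c : ℝ) (z v : Jet) : lineDeriv ℝ (fun _ : Jet => c) z v = 0 := by
  simp [lineDeriv]

/-- `b` is the derivative of the vector field `w` at `z` along `a`. -/
def FieldDeriv (w : Jet → Jet) (z a b : Jet) : Prop :=
  ∀ n, HasDerivAt (fun s : ℝ => trunc n (w (z + s • a))) (trunc n b) 0

theorem FieldDeriv.of_components {w : Jet → Jet} {z a b : Jet}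
    (h₁ : HasLineDerivAt ℝ (fun z => (w z).1) b.1 z a)
    (h₂ : HasLineDerivAt ℝ (fun z => (w z).2.1) b.2.1 z a)
    (h₃ : ∀ k, HasLineDerivAt ℝ (fun z => (w z).2.2 k) (b.2.2 k) z a) : FieldDeriv w z a b :=
  fun _ => HasDerivAt.prodMk h₁ (HasDerivAt.prodMk h₂ (hasDerivAt_pi.mpr fun k => h₃ k))

theorem fieldDeriv_const (v z a : Jet) : FieldDeriv (fun _ => v) z a 0 :=
  fun _ => hasDerivAt_const _ _

theorem hasLineDerivAt_const_fun (c : ℝ) (z a : Jet) :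
    HasLineDerivAt ℝ (fun _ : Jet => c) 0 z a := hasDerivAt_const _ _

theorem hasLineDerivAt_coordU (k : ℕ) (z a : Jet) :
    HasLineDerivAt ℝ (fun z : Jet => z.2.2 k) (a.2.2 k) z a := by
  have : HasDerivAt (fun s : ℝ => z.2.2 k + s * a.2.2 k) (a.2.2 k) 0 := by
    simpa using ((hasDerivAt_id (0 : ℝ)).mul_const (a.2.2 k)).const_add (z.2.2 k)
  exact this

theorem fieldDeriv_fieldX (z a : Jet) :
    FieldDeriv fieldX z a (0, 0, fun k => a.2.2 (k + 1)) :=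
  .of_components (hasLineDerivAt_const_fun _ _ _) (hasLineDerivAt_const_fun _ _ _)
    fun k => hasLineDerivAt_coordU (k + 1) z a

theorem hasDerivAt_fderiv_apply {E : Type*} [NormedAddCommGroup E] [NormedSpace ℝ E] {g : E → ℝ}
    {c u : ℝ → E} {a b : E} (hg : ContDiffAt ℝ ∞ g (c 0)) (hc : HasDerivAt c a 0)
    (hu : HasDerivAt u b 0) :
    HasDerivAt (fun s => fderiv ℝ g (c s) (u s))
      (fderiv ℝ (fderiv ℝ g) (c 0) a (u 0) + fderiv ℝ g (c 0) b) 0 := by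
  have h1 : HasFDerivAt (fderiv ℝ g) (fderiv ℝ (fderiv ℝ g) (c 0)) (c 0) :=
    ((hg.fderiv_right (m := 1) (WithTop.coe_le_coe.mpr le_top)).differentiableAt
      one_ne_zero).hasFDerivAt
  exact (h1.comp_hasDerivAt 0 hc).clm_apply hu

/-- The commutator formula for vector fields on the jet space. -/
theorem lineDeriv_comm {V : Set Jet} (hV : IsOpen V) {f : Jet → ℝ} (hf : IsDiffFun V f)
    {v w : Jet → Jet} {z b b' : Jet} (hz : z ∈ V) (hw : FieldDeriv w z (v z) b)
    (hv : FieldDeriv v z (w z) b') :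
    lineDeriv ℝ (fun y => lineDeriv ℝ f y (w y)) z (v z) + lineDeriv ℝ f z b' =
      lineDeriv ℝ (fun y => lineDeriv ℝ f y (v y)) z (w z) + lineDeriv ℝ f z b := by
  obtain ⟨n, g, hg, hfg⟩ := hf
  have hO := isOpenMap_trunc n _ hV
  have hmem : trunc n z ∈ trunc n '' V := Set.mem_image_of_mem _ hz
  -- The product rule yields a second-derivative term, symmetric in the two fields, and a term from
  -- differentiating the field; only the latter survives in the commutator.
  have key : ∀ {w : Jet → Jet} {a b : Jet}, FieldDeriv w z a b →
      lineDeriv ℝ (fun y => lineDeriv ℝ f y (w y)) z a =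
        fderiv ℝ (fderiv ℝ g) (trunc n z) (trunc n a) (trunc n (w z)) +
          fderiv ℝ g (trunc n z) (trunc n b) := by
    intro w a b h
    rw [lineDeriv_congr_on hV (f' := fun y => fderiv ℝ g (trunc n y) (trunc n (w y)))
      (fun y hy => (hasLineDerivAt_of_eq hV hg hfg hy _).lineDeriv) hz]
    have h2 := hasDerivAt_fderiv_apply (c := fun s : ℝ => trunc n (z + s • a))
      (u := fun s : ℝ => trunc n (w (z + s • a))) (by simpa using hg.contDiffAt (hO.mem_nhds hmem))
      (hasDerivAt_trunc_line n z a) (h n)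
    simp only [zero_smul, add_zero] at h2
    exact HasDerivAt.deriv h2
  have hsymm := (hg.contDiffAt (hO.mem_nhds hmem)).isSymmSndFDerivAt
    (by simpa using WithTop.coe_le_coe.mpr (le_top (a := (2 : ℕ∞))))
  have h := fun v => (hasLineDerivAt_of_eq hV hg hfg hz v).lineDeriv
  rw [key hw, key hv, h b, h b', hsymm.eq (trunc n (v z)) (trunc n (w z))]
  ring

end Calculus

/-! ### Commutation of `D_x` with `∂_{u_k}`, `∂_t` and `D̄_t` -/

section Commutators

variable {V : Set Jet}

theorem Dx_congr (hV : IsOpen V) {f f' : Jet → ℝ} (hf : IsDiffFun V f)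
    (h : ∀ z ∈ V, f' z = f z) {z : Jet} (hz : z ∈ V) : Dx f' z = Dx f z := by
  rw [Dx_eq hV hf hz, Dx_eq hV (hf.congr h) hz, lineDeriv_congr_on hV h hz]

theorem partialU_congr (hV : IsOpen V) {f f' : Jet → ℝ} (k : ℕ)
    (h : ∀ z ∈ V, f' z = f z) {z : Jet} (hz : z ∈ V) : partialU k f' z = partialU k f z := by
  rw [partialU_eq, partialU_eq, lineDeriv_congr_on hV h hz]

theorem partialU_zero (k : ℕ) (z : Jet) : partialU k (fun _ => 0) z = 0 := by
  rw [partialU_eq, lineDeriv_const_on]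

theorem Dx_zero (z : Jet) : Dx (fun _ => 0) z = 0 := by
  rw [Dx_eq isOpen_univ (isDiffFun_const _ 0) (Set.mem_univ z), lineDeriv_const_on]

theorem Dx_add (hV : IsOpen V) {f f' : Jet → ℝ} (hf : IsDiffFun V f) (hf' : IsDiffFun V f')
    {z : Jet} (hz : z ∈ V) : Dx (fun z => f z + f' z) z = Dx f z + Dx f' z := by
  rw [Dx_eq hV hf hz, Dx_eq hV hf' hz, Dx_eq hV (hf.add hf') hz, lineDeriv_add_on hV hf hf' hz]

theorem Dx_mul (hV : IsOpen V) {f f' : Jet → ℝ} (hf : IsDiffFun V f) (hf' : IsDiffFun V f')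
    {z : Jet} (hz : z ∈ V) : Dx (fun z => f z * f' z) z = f z * Dx f' z + f' z * Dx f z := by
  rw [Dx_eq hV hf hz, Dx_eq hV hf' hz, Dx_eq hV (hf.mul hf') hz, lineDeriv_mul_on hV hf hf' hz]

theorem DtBar_add (hV : IsOpen V) (G : Jet → ℝ) {f f' : Jet → ℝ} (hf : IsDiffFun V f)
    (hf' : IsDiffFun V f') {z : Jet} (hz : z ∈ V) :
    DtBar G (fun z => f z + f' z) z = DtBar G f z + DtBar G f' z := by
  rw [DtBar_eq hV G hf hz, DtBar_eq hV G hf' hz, DtBar_eq hV G (hf.add hf') hz,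
    lineDeriv_add_on hV hf hf' hz]

theorem DtBar_mul (hV : IsOpen V) (G : Jet → ℝ) {f f' : Jet → ℝ} (hf : IsDiffFun V f)
    (hf' : IsDiffFun V f') {z : Jet} (hz : z ∈ V) :
    DtBar G (fun z => f z * f' z) z = f z * DtBar G f' z + f' z * DtBar G f z := by
  rw [DtBar_eq hV G hf hz, DtBar_eq hV G hf' hz, DtBar_eq hV G (hf.mul hf') hz,
    lineDeriv_mul_on hV hf hf' hz]

/-- A constant vector field, differentiated along `D_x`, commutes with `D_x` up to the derivative
along the shifted vector. -/
theorem lineDeriv_Dx (hV : IsOpen V) {f : Jet → ℝ} (hf : IsDiffFun V f) {z : Jet} (hz : z ∈ V)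
    (v : Jet) : lineDeriv ℝ (Dx f) z v =
      Dx (fun y => lineDeriv ℝ f y v) z + lineDeriv ℝ f z (0, 0, fun k => v.2.2 (k + 1)) := by
  have h := lineDeriv_comm hV hf (v := fun _ => v) (w := fieldX) hz (fieldDeriv_fieldX z v)
    (fieldDeriv_const v z _)
  rw [Dx_eq hV (hf.lineDeriv_const hV v) hz, ← h,
    lineDeriv_congr_on hV (fun y hy => Dx_eq hV hf hy) hz]
  simp [lineDeriv]

theorem partialU_succ_Dx (hV : IsOpen V) {f : Jet → ℝ} (hf : IsDiffFun V f) {z : Jet} (hz : z ∈ V)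
    (k : ℕ) : partialU (k + 1) (Dx f) z = Dx (partialU (k + 1) f) z + partialU k f z := by
  rw [partialU_eq, lineDeriv_Dx hV hf hz, partialU_eq,
    Dx_congr hV (hf.lineDeriv_const hV _) (fun y _ => partialU_eq (k + 1) f y) hz]
  congr 2
  refine Prod.ext rfl (Prod.ext rfl (funext fun j => ?_))
  simp [eU, Pi.single_apply]

theorem partialU_zero_Dx (hV : IsOpen V) {f : Jet → ℝ} (hf : IsDiffFun V f) {z : Jet}
    (hz : z ∈ V) : partialU 0 (Dx f) z = Dx (partialU 0 f) z := by
  rw [partialU_eq, lineDeriv_Dx hV hf hz,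
    Dx_congr hV (hf.lineDeriv_const hV _) (fun y _ => partialU_eq 0 f y) hz]
  have : ((0, 0, fun k => (eU 0).2.2 (k + 1)) : Jet) = 0 :=
    Prod.ext rfl (Prod.ext rfl (funext fun j => by simp [eU]))
  rw [this]
  simp [lineDeriv]

theorem partialT_Dx (hV : IsOpen V) {f : Jet → ℝ} (hf : IsDiffFun V f) {z : Jet}
    (hz : z ∈ V) : partialT (Dx f) z = Dx (partialT f) z := by
  rw [partialT_eq, lineDeriv_Dx hV hf hz,
    Dx_congr hV (hf.lineDeriv_const hV _) (fun y _ => partialT_eq f y) hz]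
  have : ((0, 0, fun k => eT.2.2 (k + 1)) : Jet) = 0 := rfl
  rw [this]
  simp [lineDeriv]

theorem lineDeriv_lineDeriv_comm (hV : IsOpen V) {f : Jet → ℝ} (hf : IsDiffFun V f) {z : Jet}
    (hz : z ∈ V) (v w : Jet) : lineDeriv ℝ (fun y => lineDeriv ℝ f y w) z v =
      lineDeriv ℝ (fun y => lineDeriv ℝ f y v) z w := by
  simpa using lineDeriv_comm hV hf (v := fun _ => v) (w := fun _ => w) hz
    (fieldDeriv_const _ _ _) (fieldDeriv_const _ _ _)

/-- Differentiating either field along the other gives the same vector, with `u_k`-component `D_xᵏ⁺¹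
G`, so the commutator vanishes. -/
theorem DtBar_Dx (hV : IsOpen V) {G f : Jet → ℝ} (hG : IsDiffFun V G) (hf : IsDiffFun V f)
    {z : Jet} (hz : z ∈ V) : DtBar G (Dx f) z = Dx (DtBar G f) z := by
  have hT : FieldDeriv (fieldT G) z (fieldX z) (0, 0, fun k => (Dx^[k + 1] G) z) := by
    refine .of_components (hasLineDerivAt_const_fun _ _ _) (hasLineDerivAt_const_fun _ _ _)
      fun k => ?_
    have := (hG.iterate_Dx hV k).hasLineDerivAt hV hz (fieldX z)
    rwa [← Dx_eq hV (hG.iterate_Dx hV k) hz, ← Function.iterate_succ_apply' Dx] at this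
  have h := lineDeriv_comm hV hf (v := fieldT G) (w := fieldX) hz
    (fieldDeriv_fieldX z (fieldT G z)) hT
  rw [DtBar_eq hV G (hf.Dx hV) hz, Dx_eq hV (IsDiffFun.DtBar hV hG hf) hz,
    lineDeriv_congr_on hV (fun y hy => Dx_eq hV hf hy) hz,
    lineDeriv_congr_on hV (fun y hy => DtBar_eq hV G hf hy) hz]
  exact add_right_cancel h

theorem iterate_Dx_congr (hV : IsOpen V) {f f' : Jet → ℝ} (hf : IsDiffFun V f)
    (h : ∀ z ∈ V, f' z = f z) (k : ℕ) {z : Jet} (hz : z ∈ V) : (Dx^[k] f') z = (Dx^[k] f) z := by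
  induction k generalizing z with
  | zero => exact h z hz
  | succ k ih =>
    rw [Function.iterate_succ_apply', Function.iterate_succ_apply']
    exact Dx_congr hV (hf.iterate_Dx hV k) (fun z hz => ih hz) hz

theorem iterate_Dx_zero (k : ℕ) : Dx^[k] (fun _ => 0) = fun _ => 0 := by
  induction k with
  | zero => rfl
  | succ k ih => rw [Function.iterate_succ_apply', ih]; exact funext Dx_zero

theorem varDeriv_eq_sum (hV : IsOpen V) {f : Jet → ℝ} {n : ℕ}
    (h0 : ∀ k, n ≤ k → ∀ z ∈ V, partialU k f z = 0) {z : Jet} (hz : z ∈ V) :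
    varDeriv f z = ∑ k ∈ Finset.range n, (-1) ^ k * (Dx^[k] (partialU k f)) z := by
  rw [varDeriv, finsum_eq_sum_of_support_subset]
  intro k hk
  by_contra h
  refine hk ?_
  simp only [Finset.coe_range, Set.mem_Iio, not_lt] at h
  have := iterate_Dx_congr hV (isDiffFun_const V 0) (h0 k h) k hz
  simp only [this, iterate_Dx_zero, mul_zero]

/-- Order is measured from here on by vanishing partial derivatives: on a nonconvex set these need
not give a representative with fewer arguments. -/
theorem IsDiffFun.exists_bound (hV : IsOpen V) {f : Jet → ℝ} (hf : IsDiffFun V f) :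
    ∃ n, ∀ k, n ≤ k → ∀ z ∈ V, EvolutionCL.partialU k f z = 0 := by
  obtain ⟨n, hn⟩ := hf
  exact ⟨n + 1, fun k hk z hz => hn.partialU_eq_zero hV (by omega) hz⟩

theorem IsDiffFun.varDeriv (hV : IsOpen V) {f : Jet → ℝ} (hf : IsDiffFun V f) :
    IsDiffFun V (varDeriv f) := by
  obtain ⟨n, hn⟩ := hf.exists_bound hV
  exact (IsDiffFun.sum (Finset.range n) fun k => (isDiffFun_const V ((-1) ^ k)).mul
    ((hf.partialU hV k).iterate_Dx hV k)).congr fun z hz => varDeriv_eq_sum hV hn hz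

end Commutators

/-! ### Differential functions on an open set as a differential algebra -/

section DiffAlg

/-- The algebra of differential functions on `V`. -/
def diffAlg (V : Set Jet) : Subalgebra ℝ (V → ℝ) where
  carrier := {a | ∃ f, IsDiffFun V f ∧ ∀ z : V, a z = f z}
  mul_mem' := by
    rintro a b ⟨f, hf, ha⟩ ⟨g, hg, hb⟩
    exact ⟨_, hf.mul hg, fun z => by simp [ha, hb]⟩
  add_mem' := by
    rintro a b ⟨f, hf, ha⟩ ⟨g, hg, hb⟩
    exact ⟨_, hf.add hg, fun z => by simp [ha, hb]⟩
  algebraMap_mem' c := ⟨_, isDiffFun_const V c, fun _ => rfl⟩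

variable {V : Set Jet}

/-- The element `a` of `diffAlg V` is the restriction of `f` to `V`. -/
def Rep (a : diffAlg V) (f : Jet → ℝ) : Prop := ∀ z (hz : z ∈ V), a.1 ⟨z, hz⟩ = f z

theorem exists_rep {f : Jet → ℝ} (hf : IsDiffFun V f) : ∃ a : diffAlg V, Rep a f :=
  ⟨⟨fun z => f z, f, hf, fun _ => rfl⟩, fun _ _ => rfl⟩

theorem Rep.isDiffFun {a : diffAlg V} {f : Jet → ℝ} (h : Rep a f) : IsDiffFun V f := by
  obtain ⟨g, hg, e⟩ := a.2
  exact hg.congr fun z hz => (h z hz).symm.trans (e ⟨z, hz⟩)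

theorem Rep.eq {a b : diffAlg V} {f g : Jet → ℝ} (ha : Rep a f) (hb : Rep b g)
    (h : ∀ z ∈ V, f z = g z) : a = b :=
  Subtype.ext (funext fun z => by rw [ha z.1 z.2, hb z.1 z.2, h z.1 z.2])

theorem Rep.eqOn {a b : diffAlg V} {f g : Jet → ℝ} (ha : Rep a f) (hb : Rep b g)
    (h : a = b) : ∀ z ∈ V, f z = g z := fun z hz => by
  rw [← ha z hz, ← hb z hz, h]

theorem Rep.add {a b : diffAlg V} {f g : Jet → ℝ} (ha : Rep a f) (hb : Rep b g) :
    Rep (a + b) (fun z => f z + g z) := fun z hz =>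
  congrArg₂ (· + ·) (ha z hz) (hb z hz)

theorem Rep.sub {a b : diffAlg V} {f g : Jet → ℝ} (ha : Rep a f) (hb : Rep b g) :
    Rep (a - b) (fun z => f z - g z) := fun z hz =>
  congrArg₂ (· - ·) (ha z hz) (hb z hz)

theorem Rep.mul {a b : diffAlg V} {f g : Jet → ℝ} (ha : Rep a f) (hb : Rep b g) :
    Rep (a * b) (fun z => f z * g z) := fun z hz =>
  congrArg₂ (· * ·) (ha z hz) (hb z hz)

theorem rep_zero : Rep (0 : diffAlg V) (fun _ => 0) := fun _ _ => rfl

theorem rep_one : Rep (1 : diffAlg V) (fun _ => 1) := fun _ _ => rfl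

theorem rep_neg_one_pow (i : ℕ) : Rep ((-1 : diffAlg V) ^ i) (fun _ => (-1) ^ i) :=
  fun _ _ => rfl

theorem Rep.sum {ι : Type*} (s : Finset ι) {a : ι → diffAlg V} {f : ι → Jet → ℝ}
    (h : ∀ i, Rep (a i) (f i)) : Rep (∑ i ∈ s, a i) (fun z => ∑ i ∈ s, f i z) := fun z hz => by
  rw [AddSubmonoidClass.coe_finsetSum, Finset.sum_apply]
  exact Finset.sum_congr rfl fun i _ => h i z hz

theorem Rep.det {k : ℕ} {M : Matrix (Fin k) (Fin k) (diffAlg V)} {F : Fin k → Fin k → Jet → ℝ}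
    (h : ∀ i j, Rep (M i j) (F i j)) : Rep M.det (fun z => (Matrix.of fun i j => F i j z).det) := by
  intro z hz
  have := RingHom.map_det ((Pi.evalRingHom (fun _ : V => ℝ) ⟨z, hz⟩).comp
    (diffAlg V).val.toRingHom) M
  refine Eq.trans this ?_
  congr 1
  ext i j
  exact h i j z hz

theorem Rep.exists_inv {a : diffAlg V} {f : Jet → ℝ} (ha : Rep a f) (h0 : ∀ z ∈ V, f z ≠ 0) :
    ∃ b, a * b = 1 ∧ Rep b (fun z => (f z)⁻¹) := by
  obtain ⟨b, hb⟩ := exists_rep (ha.isDiffFun.inv h0)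
  exact ⟨b, (ha.mul hb).eq rep_one fun z hz => mul_inv_cancel₀ (h0 z hz), hb⟩

open Classical in
/-- The extension by zero of a differential function on `V`. -/
noncomputable def extend (a : diffAlg V) (z : Jet) : ℝ := if h : z ∈ V then a.1 ⟨z, h⟩ else 0

theorem rep_extend (a : diffAlg V) : Rep a (extend a) := fun z hz => by simp [extend, hz]

/-- The total derivative as a derivation of the algebra of differential functions. -/
noncomputable def totalD (hV : IsOpen V) : Derivation ℝ (diffAlg V) (diffAlg V) :=
  Derivation.mk'
    { toFun := fun a => ⟨fun z => Dx (extend a) z, _, (rep_extend a).isDiffFun.Dx hV, fun _ => rfl⟩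
      map_add' := fun a b => Subtype.ext (funext fun z => by
        refine Eq.trans ?_ (Dx_add hV (rep_extend a).isDiffFun (rep_extend b).isDiffFun z.2)
        exact Dx_congr hV ((rep_extend a).add (rep_extend b)).isDiffFun
          (fun y hy => by rw [← rep_extend _ y hy, ← rep_extend _ y hy, ← rep_extend _ y hy]; rfl)
          z.2)
      map_smul' := fun c a => Subtype.ext (funext fun z => by
        have h := Dx_mul hV (isDiffFun_const V c) (rep_extend a).isDiffFun z.2
        rw [Dx_eq hV (isDiffFun_const V c) z.2, lineDeriv_const_on, mul_zero, add_zero] at h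
        refine Eq.trans ?_ h
        exact Dx_congr hV ((isDiffFun_const V c).mul (rep_extend a).isDiffFun)
          (fun y hy => by rw [← rep_extend _ y hy, ← rep_extend _ y hy]; rfl) z.2) }
    (fun a b => Subtype.ext (funext fun z => by
      refine (Dx_congr hV ((rep_extend a).mul (rep_extend b)).isDiffFun
        (fun y hy => by rw [← rep_extend _ y hy, ← rep_extend _ y hy, ← rep_extend _ y hy]; rfl)
        z.2).trans ?_
      refine (Dx_mul hV (rep_extend a).isDiffFun (rep_extend b).isDiffFun z.2).trans ?_
      rw [← rep_extend _ z z.2, ← rep_extend _ z z.2]; rfl))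

/-- On the open set `V`, `D_x` sees only germs, so the choice of extension outside `V` is
immaterial. -/
theorem Rep.totalD (hV : IsOpen V) {a : diffAlg V} {f : Jet → ℝ} (ha : Rep a f) :
    Rep (totalD hV a) (Dx f) := fun z hz =>
  Dx_congr hV ha.isDiffFun (fun y hy => by rw [← rep_extend _ y hy, ha y hy]) hz

theorem Rep.iterate (hV : IsOpen V) {a : diffAlg V} {f : Jet → ℝ} (ha : Rep a f) (k : ℕ) :
    Rep ((EvolutionCL.totalD hV)^[k] a) (Dx^[k] f) := by
  induction k with
  | zero => exact ha
  | succ k ih =>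
    rw [Function.iterate_succ_apply', Function.iterate_succ_apply']
    exact ih.totalD hV

theorem Rep.wronskian (hV : IsOpen V) {k : ℕ} {a : Fin k → diffAlg V} {f : Fin k → Jet → ℝ}
    (h : ∀ i, Rep (a i) (f i)) : Rep (wrMatrix (EvolutionCL.totalD hV) a).det (wronskian f) :=
  Rep.det fun i j => (h j).iterate hV i

theorem Rep.darbouxCoeff (hV : IsOpen V) {k : ℕ} {a : Fin k → diffAlg V} {f : Fin k → Jet → ℝ}
    (h : ∀ i, Rep (a i) (f i)) {w : diffAlg V}
    (hw : Rep w (fun z => (EvolutionCL.wronskian f z)⁻¹)) (i : Fin (k + 1)) :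
    Rep (dtCoeff (EvolutionCL.totalD hV) a w i) (darbouxCoeff f i) := by
  have h1 : Rep (Matrix.det (Matrix.of fun r b : Fin k =>
      (EvolutionCL.totalD hV)^[((i.succAbove r : Fin (k + 1)) : ℕ)] (a b))) _ :=
    Rep.det fun r b => (h b).iterate hV (i.succAbove r)
  intro z hz
  exact (((rep_neg_one_pow _).mul h1).mul hw z hz).trans (by rw [EvolutionCL.darbouxCoeff, div_eq_mul_inv])

theorem Rep.darbouxAdjoint (hV : IsOpen V) {k : ℕ} {a : Fin k → diffAlg V} {f : Fin k → Jet → ℝ}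
    (h : ∀ i, Rep (a i) (f i)) {w : diffAlg V}
    (hw : Rep w (fun z => (EvolutionCL.wronskian f z)⁻¹)) {b : diffAlg V} {g : Jet → ℝ}
    (hb : Rep b g) :
    Rep (opAdj (EvolutionCL.totalD hV) (dtCoeff (EvolutionCL.totalD hV) a w) b)
      (darbouxAdjoint f g) :=
  Rep.sum _ fun i => (rep_neg_one_pow _).mul
    (((Rep.darbouxCoeff hV h hw i).mul hb).iterate hV i)

end DiffAlg

/-! ### The variational derivative -/

section Euler

variable {V : Set Jet}

theorem iterate_Dx_add (hV : IsOpen V) {f f' : Jet → ℝ} (hf : IsDiffFun V f)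
    (hf' : IsDiffFun V f') (k : ℕ) {z : Jet} (hz : z ∈ V) :
    (Dx^[k] (fun z => f z + f' z)) z = (Dx^[k] f) z + (Dx^[k] f') z := by
  induction k generalizing z with
  | zero => rfl
  | succ k ih =>
    simp only [Function.iterate_succ_apply']
    rw [← Dx_add hV (hf.iterate_Dx hV k) (hf'.iterate_Dx hV k) hz]
    exact Dx_congr hV ((hf.iterate_Dx hV k).add (hf'.iterate_Dx hV k)) (fun y hy => ih hy) hz

theorem iterate_Dx_mul_of_Dx_eq_zero (hV : IsOpen V) {c f : Jet → ℝ} (hc : IsDiffFun V c)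
    (hf : IsDiffFun V f) (h0 : ∀ z ∈ V, Dx c z = 0) (k : ℕ) {z : Jet} (hz : z ∈ V) :
    (Dx^[k] (fun z => c z * f z)) z = c z * (Dx^[k] f) z := by
  induction k generalizing z with
  | zero => rfl
  | succ k ih =>
    simp only [Function.iterate_succ_apply']
    rw [Dx_congr hV (hc.mul (hf.iterate_Dx hV k)) (fun y hy => ih hy) hz,
      Dx_mul hV hc (hf.iterate_Dx hV k) hz, h0 z hz, mul_zero, add_zero]

theorem partialU_add (hV : IsOpen V) {f f' : Jet → ℝ} (hf : IsDiffFun V f)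
    (hf' : IsDiffFun V f') (k : ℕ) {z : Jet} (hz : z ∈ V) :
    partialU k (fun z => f z + f' z) z = partialU k f z + partialU k f' z := by
  simp only [partialU_eq, lineDeriv_add_on hV hf hf' hz]

theorem varDeriv_add (hV : IsOpen V) {f f' : Jet → ℝ} (hf : IsDiffFun V f)
    (hf' : IsDiffFun V f') {z : Jet} (hz : z ∈ V) :
    varDeriv (fun z => f z + f' z) z = varDeriv f z + varDeriv f' z := by
  obtain ⟨n, hn⟩ := hf.exists_bound hV
  obtain ⟨n', hn'⟩ := hf'.exists_bound hV
  have h1 : ∀ k, max n n' ≤ k → ∀ z ∈ V, partialU k (fun z => f z + f' z) z = 0 :=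
    fun k hk z hz => by
      rw [partialU_add hV hf hf' k hz, hn k (le_of_max_le_left hk) z hz,
        hn' k (le_of_max_le_right hk) z hz, add_zero]
  rw [varDeriv_eq_sum hV h1 hz, varDeriv_eq_sum hV (fun k hk => hn k (le_of_max_le_left hk)) hz,
    varDeriv_eq_sum hV (fun k hk => hn' k (le_of_max_le_right hk)) hz, ← Finset.sum_add_distrib]
  refine Finset.sum_congr rfl fun k _ => ?_
  rw [← mul_add, ← iterate_Dx_add hV (hf.partialU hV k) (hf'.partialU hV k) k hz,
    iterate_Dx_congr hV ((hf.partialU hV k).add (hf'.partialU hV k))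
      (fun y hy => partialU_add hV hf hf' k hy) k hz]

/-- Such a `c` passes through `D_x` and every `∂_{u_k}`. Functions of `t`, not only constants, occur
as coefficients in relations between characteristics. -/
theorem varDeriv_mul_of_Dx_eq_zero (hV : IsOpen V) {c f : Jet → ℝ} (hc : IsDiffFun V c)
    (hf : IsDiffFun V f) (h0 : ∀ z ∈ V, Dx c z = 0) (hu : ∀ k, ∀ z ∈ V, partialU k c z = 0)
    {z : Jet} (hz : z ∈ V) :
    varDeriv (fun z => c z * f z) z = c z * varDeriv f z := by
  obtain ⟨n, hn⟩ := hf.exists_bound hV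
  have h2 : ∀ k, ∀ z ∈ V, partialU k (fun z => c z * f z) z = c z * partialU k f z :=
    fun k z hz => by
      have := hu k z hz
      rw [partialU_eq] at this ⊢
      rw [lineDeriv_mul_on hV hc hf hz, this, partialU_eq, mul_zero, add_zero]
  have h1 : ∀ k, n ≤ k → ∀ z ∈ V, partialU k (fun z => c z * f z) z = 0 :=
    fun k hk z hz => by rw [h2 k z hz, hn k hk z hz, mul_zero]
  rw [varDeriv_eq_sum hV h1 hz, varDeriv_eq_sum hV hn hz, Finset.mul_sum]
  refine Finset.sum_congr rfl fun k _ => ?_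
  rw [iterate_Dx_congr hV (hc.mul (hf.partialU hV k)) (h2 k) k hz,
    iterate_Dx_mul_of_Dx_eq_zero hV hc (hf.partialU hV k) h0 k hz]
  ring

theorem varDeriv_zero (z : Jet) : varDeriv (fun _ => 0) z = 0 := by
  rw [varDeriv_eq_sum (V := Set.univ) (n := 0) isOpen_univ (fun k _ z _ => partialU_zero k z)
    (Set.mem_univ z), Finset.range_zero, Finset.sum_empty]

theorem varDeriv_congr (hV : IsOpen V) {f f' : Jet → ℝ} (hf : IsDiffFun V f)
    (h : ∀ z ∈ V, f' z = f z) {z : Jet} (hz : z ∈ V) : varDeriv f' z = varDeriv f z := by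
  obtain ⟨n, hn⟩ := hf.exists_bound hV
  rw [varDeriv_eq_sum hV hn hz, varDeriv_eq_sum (f := f') hV (fun k hk z hz => by
    rw [partialU_congr hV k h hz, hn k hk z hz]) hz]
  refine Finset.sum_congr rfl fun k _ => ?_
  rw [iterate_Dx_congr hV (hf.partialU hV k) (fun y hy => partialU_congr hV k h hy) k hz]

theorem varDeriv_sum_mul (hV : IsOpen V) {ι : Type*} (s : Finset ι) {c f : ι → Jet → ℝ}
    (hc : ∀ i, IsDiffFun V (c i)) (hf : ∀ i, IsDiffFun V (f i))
    (h0 : ∀ i, ∀ z ∈ V, Dx (c i) z = 0) (hu : ∀ i k, ∀ z ∈ V, partialU k (c i) z = 0)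
    {z : Jet} (hz : z ∈ V) :
    varDeriv (fun z => ∑ i ∈ s, c i z * f i z) z = ∑ i ∈ s, c i z * varDeriv (f i) z := by
  classical
  induction s using Finset.induction_on with
  | empty => simpa using varDeriv_zero z
  | insert i s hi ih =>
    simp only [Finset.sum_insert hi]
    rw [varDeriv_add hV ((hc i).mul (hf i)) (IsDiffFun.sum s fun i => (hc i).mul (hf i)) hz, ih,
      varDeriv_mul_of_Dx_eq_zero hV (hc i) (hf i) (h0 i) (hu i) hz]

/-- Total derivatives are annihilated by the variational derivative. -/
theorem varDeriv_Dx (hV : IsOpen V) {f : Jet → ℝ} (hf : IsDiffFun V f) {z : Jet} (hz : z ∈ V) :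
    varDeriv (Dx f) z = 0 := by
  obtain ⟨n, hn⟩ := hf.exists_bound hV
  have h1 : ∀ k, n + 1 ≤ k → ∀ z ∈ V, partialU k (Dx f) z = 0 := by
    intro k hk z hz
    obtain ⟨j, rfl⟩ : ∃ j, k = j + 1 := ⟨k - 1, by omega⟩
    rw [partialU_succ_Dx hV hf hz, hn j (by omega) z hz,
      Dx_congr hV (isDiffFun_const V 0) (hn (j + 1) (by omega)) hz, Dx_zero, add_zero]
  -- The sum telescopes because `∂_{u_{k+1}} D_x = D_x ∂_{u_{k+1}} + ∂_{u_k}`; the remaining term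
  -- vanishes beyond the order of `f`.
  have h2 : ∀ m, ∑ k ∈ Finset.range (m + 1), (-1) ^ k * (Dx^[k] (partialU k (Dx f))) z =
      (-1) ^ m * (Dx^[m + 1] (partialU m f)) z := by
    intro m
    induction m with
    | zero => simp [partialU_zero_Dx hV hf hz]
    | succ m ih =>
      rw [Finset.sum_range_succ, ih,
        iterate_Dx_congr hV (((hf.partialU hV (m + 1)).Dx hV).add (hf.partialU hV m))
          (fun y hy => partialU_succ_Dx hV hf hy m) (m + 1) hz,
        iterate_Dx_add hV ((hf.partialU hV (m + 1)).Dx hV) (hf.partialU hV m) (m + 1) hz,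
        ← Function.iterate_succ_apply Dx, pow_succ]
      ring
  rw [varDeriv_eq_sum hV h1 hz, h2, iterate_Dx_congr hV (isDiffFun_const V 0) (hn n le_rfl) _ hz,
    iterate_Dx_zero, mul_zero]

/-- Each `D_x` raises the order by at most one and carries the derivative in the top variable along
unchanged. -/
theorem partialU_iterate_Dx (hV : IsOpen V) {f : Jet → ℝ} (hf : IsDiffFun V f) {m : ℕ}
    (hm : ∀ k, m < k → ∀ z ∈ V, partialU k f z = 0) (k : ℕ) :
    (∀ j, m + k < j → ∀ z ∈ V, partialU j (Dx^[k] f) z = 0) ∧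
      ∀ z ∈ V, partialU (m + k) (Dx^[k] f) z = partialU m f z := by
  induction k with
  | zero => exact ⟨hm, fun _ _ => rfl⟩
  | succ k ih =>
    have hk := hf.iterate_Dx hV k
    have h1 : ∀ j, m + k ≤ j → ∀ z ∈ V,
        partialU (j + 1) (Dx^[k + 1] f) z = partialU j (Dx^[k] f) z := by
      intro j hj z hz
      rw [Function.iterate_succ_apply', partialU_succ_Dx hV hk hz,
        Dx_congr hV (isDiffFun_const V 0) (ih.1 (j + 1) (by omega)) hz, Dx_zero, zero_add]
    refine ⟨fun j hj z hz => ?_, fun z hz => ?_⟩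
    · obtain ⟨i, rfl⟩ : ∃ i, j = i + 1 := ⟨j - 1, by omega⟩
      rw [h1 i (by omega) z hz, ih.1 i (by omega) z hz]
    · exact (h1 (m + k) le_rfl z hz).trans (ih.2 z hz)

/-- The top-order part of the variational derivative. -/
theorem partialU_varDeriv_top (hV : IsOpen V) {f : Jet → ℝ} (hf : IsDiffFun V f) {m : ℕ}
    (hm : ∀ k, m < k → ∀ z ∈ V, partialU k f z = 0) {z : Jet} (hz : z ∈ V) :
    partialU (m + m) (varDeriv f) z = (-1) ^ m * partialU m (partialU m f) z := by
  have hf' : ∀ k, IsDiffFun V (fun z => (-1) ^ k * (Dx^[k] (partialU k f)) z) := fun k =>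
    (isDiffFun_const V ((-1) ^ k)).mul ((hf.partialU hV k).iterate_Dx hV k)
  have hp : ∀ k j, m < j → ∀ z ∈ V, partialU j (partialU k f) z = 0 := by
    intro k j hj z hz
    rw [partialU_eq, lineDeriv_congr_on hV (fun y _ => partialU_eq k f y) hz,
      lineDeriv_lineDeriv_comm hV hf hz,
      ← lineDeriv_congr_on hV (fun y _ => partialU_eq j f y) hz,
      lineDeriv_congr_on hV (hm j hj) hz, lineDeriv_const_on]
  have hc : ∀ k, partialU (m + m) (fun z => (-1) ^ k * (Dx^[k] (partialU k f)) z) z =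
      (-1) ^ k * partialU (m + m) (Dx^[k] (partialU k f)) z := by
    intro k
    rw [partialU_eq, partialU_eq, lineDeriv_mul_on hV (isDiffFun_const V ((-1) ^ k))
      ((hf.partialU hV k).iterate_Dx hV k) hz, lineDeriv_const_on, mul_zero, add_zero]
  -- The `k`-th term has order at most `m + k`, so only `k = m` reaches `u_{2m}`.
  have hz' : ∀ k < m, partialU (m + m) (Dx^[k] (partialU k f)) z = 0 := fun k hk =>
    (partialU_iterate_Dx hV (hf.partialU hV k) (hp k) k).1 (m + m) (by omega) z hz
  rw [partialU_congr hV (m + m) (fun y hy => varDeriv_eq_sum hV (n := m + 1) (fun k hk => hm k hk)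
    hy) hz]
  have hsum : ∀ s : Finset ℕ, partialU (m + m)
      (fun y => ∑ k ∈ s, (-1) ^ k * (Dx^[k] (partialU k f)) y) z =
      ∑ k ∈ s, (-1) ^ k * partialU (m + m) (Dx^[k] (partialU k f)) z := by
    intro s
    induction s using Finset.induction_on with
    | empty => simpa using partialU_zero (m + m) z
    | insert i s hi ih =>
      simp only [Finset.sum_insert hi]
      rw [partialU_add hV (hf' i) (IsDiffFun.sum s hf') _ hz, ih, hc]
  rw [hsum, Finset.sum_range_succ, Finset.sum_eq_zero, zero_add,
    (partialU_iterate_Dx hV (hf.partialU hV m) (hp m) m).2 z hz]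
  intro k hk
  rw [hz' k (Finset.mem_range.mp hk), mul_zero]

/-- `D̄_t ρ` equals `∂_t ρ + (δρ/δu) G` up to a total derivative. -/
theorem exists_DtBar_eq (hV : IsOpen V) {G f : Jet → ℝ} (hG : IsDiffFun V G) (hf : IsDiffFun V f) :
    ∃ σ, IsDiffFun V σ ∧ ∀ z ∈ V, DtBar G f z = partialT f z + varDeriv f z * G z + Dx σ z := by
  obtain ⟨n, hn⟩ := hf
  have hf : IsDiffFun V f := ⟨n, hn⟩
  obtain ⟨g, hg⟩ := exists_rep hG
  have hr := fun k => exists_rep (hf.partialU hV k)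
  choose r hr using hr
  -- Each term `(D_xᵏ G) ∂f/∂u_k` is integrated by parts `k` times.
  have key : ∀ m, ∃ c : diffAlg V, ∑ k ∈ Finset.range m, (totalD hV)^[k] g * r k =
      (∑ k ∈ Finset.range m, (-1) ^ k * (totalD hV)^[k] (r k)) * g + totalD hV c := by
    intro m
    induction m with
    | zero => exact ⟨0, by simp⟩
    | succ m ih =>
      obtain ⟨c, hc⟩ := ih
      obtain ⟨d, hd⟩ := iterate_sub_mem (totalD hV) m (r m) g
      refine ⟨c + d, ?_⟩
      rw [Finset.sum_range_succ, hc, Finset.sum_range_succ, map_add,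
        show totalD hV d = _ from hd]
      ring
  obtain ⟨c, hc⟩ := key (n + 1)
  refine ⟨extend c, (rep_extend c).isDiffFun, fun z hz => ?_⟩
  have h1 := (Rep.sum (Finset.range (n + 1)) fun k => (hg.iterate hV k).mul (hr k)).eqOn
    (((Rep.sum (Finset.range (n + 1)) fun k => (rep_neg_one_pow k).mul
      ((hr k).iterate hV k)).mul hg).add ((rep_extend c).totalD hV)) hc z hz
  rw [DtBar_eq hV G hf hz, lineDeriv_eq_sum hV hn hz,
    varDeriv_eq_sum hV (n := n + 1) (fun k hk z hz => hn.partialU_eq_zero hV (by omega) hz) hz]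
  simp only [fieldT, one_mul, zero_mul, add_zero]
  rw [h1]
  ring

end Euler

/-! ### Local exactness and trivial currents -/

section Exactness

variable {V : Set Jet}

theorem exists_convex_nhds (hV : IsOpen V) {z : Jet} (hz : z ∈ V) :
    ∃ W : Set Jet, IsOpen W ∧ Convex ℝ W ∧ z ∈ W ∧ W ⊆ V := by
  obtain ⟨s, ⟨hs, hc⟩, hsV⟩ :=
    (LocallyConvexSpace.convex_basis (𝕜 := ℝ) z).mem_iff.mp (hV.mem_nhds hz)
  exact ⟨interior s, isOpen_interior, hc.interior, mem_interior_iff_mem_nhds.mpr hs,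
    interior_subset.trans hsV⟩

theorem eq_of_lineDeriv_eq_zero (hV : IsOpen V) (hc : Convex ℝ V) {f : Jet → ℝ}
    (hf : IsDiffFun V f) {z w : Jet} (hz : z ∈ V) (hw : w ∈ V)
    (h : ∀ y ∈ V, lineDeriv ℝ f y (w - z) = 0) : f w = f z := by
  have hm : ∀ s ∈ Set.Icc (0 : ℝ) 1, z + s • (w - z) ∈ V := fun s hs =>
    hc.add_smul_sub_mem hz hw hs
  have hd : ∀ s ∈ Set.Icc (0 : ℝ) 1, HasDerivAt (fun s : ℝ => f (z + s • (w - z))) 0 s := by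
    intro s hs
    have h1 := hf.hasLineDerivAt hV (hm s hs) (w - z)
    rw [h _ (hm s hs)] at h1
    have h2 : HasDerivAt (fun τ : ℝ => f (z + s • (w - z) + (τ - s) • (w - z))) 0 s :=
      HasDerivAt.comp_sub_const (f := fun τ : ℝ => f (z + s • (w - z) + τ • (w - z))) s s
        (by rw [sub_self]; exact h1)
    refine h2.congr_of_eventuallyEq (Filter.Eventually.of_forall fun τ => ?_)
    simp only
    congr 1
    module
  have := constant_of_has_deriv_right_zero (f := fun s : ℝ => f (z + s • (w - z))) (a := 0) (b := 1)
    (fun s hs => (hd s hs).continuousAt.continuousWithinAt)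
    (fun s hs => (hd s (Set.Ico_subset_Icc_self hs)).hasDerivWithinAt) 1 (by simp)
  simpa using this

/-- Multiplication of the coordinates of a jet by constants. -/
def mask (a b : ℝ) (m : ℕ → ℝ) : Jet →L[ℝ] Jet where
  toFun v := (a * v.1, b * v.2.1, fun k => m k * v.2.2 k)
  map_add' v w := by
    refine Prod.ext ?_ (Prod.ext ?_ (funext fun k => ?_)) <;> simp [mul_add]
  map_smul' c v := by
    refine Prod.ext ?_ (Prod.ext ?_ (funext fun k => ?_)) <;> simp [mul_left_comm]
  cont := by fun_prop

theorem mask_apply (a b : ℝ) (m : ℕ → ℝ) (v : Jet) :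
    mask a b m v = (a * v.1, b * v.2.1, fun k => m k * v.2.2 k) := rfl

/-- A differential function which depends only on the coordinates selected by a mask has locally
an antiderivative of the same kind in the direction of any selected coordinate. -/
theorem exists_local_antiderivative (hV : IsOpen V) {f : Jet → ℝ} (hf : IsDiffFun V f)
    {z₀ : Jet} (hz₀ : z₀ ∈ V) (a b : ℝ) (m : ℕ → ℝ)
    (h0 : ∀ z ∈ V, ∀ v, lineDeriv ℝ f z (v - mask a b m v) = 0) (e : Jet) (he : mask a b m e = e)
    {N₀ : ℕ} (heN : ∀ N, N₀ ≤ N → trunc N e ≠ 0) :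
    ∃ W : Set Jet, IsOpen W ∧ z₀ ∈ W ∧ W ⊆ V ∧ ∃ Θ : Jet → ℝ, IsDiffFun W Θ ∧
      (∀ z ∈ W, lineDeriv ℝ Θ z e = f z) ∧
      ∀ v, mask a b m v = 0 → ∀ z ∈ W, lineDeriv ℝ Θ z v = 0 := by
  obtain ⟨N₁, hN₁⟩ := hf
  obtain ⟨g, hg, hfg⟩ := hN₁.mono_order (le_max_right N₀ N₁)
  have hf : IsDiffFun V f := ⟨_, hN₁⟩
  set N := max N₀ N₁
  obtain ⟨g', hg', hgg'⟩ := exists_contDiff_eventuallyEq (isOpenMap_trunc N _ hV) hg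
    (Set.mem_image_of_mem _ hz₀)
  obtain ⟨l, hl⟩ := SeparatingDual.exists_eq_one (R := ℝ) (heN N (le_max_left _ _))
  obtain ⟨F, hF, hFe⟩ := exists_contDiff_antiderivative hg' l (trunc N e) hl
  obtain ⟨W₀, hW₀, hW₀c, hz₀W, hWV⟩ := exists_convex_nhds hV hz₀
  obtain ⟨O, hO, hOo, hOz⟩ := eventually_nhds_iff.mp hgg'
  -- For a mask of zeros and ones, `P` freezes the unselected coordinates at their values at `z₀`;
  -- composing the antiderivative with `P` removes any dependence on them.
  set P : Jet → Jet := fun z => z₀ + mask a b m (z - z₀) with hP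
  have hPc : Continuous P := by fun_prop
  have hP0 : P z₀ = z₀ := by simp [hP]
  let p : ℝ × ℝ × (Fin (N + 1) → ℝ) → ℝ × ℝ × (Fin (N + 1) → ℝ) := fun y =>
    (z₀.1 + a * (y.1 - z₀.1), z₀.2.1 + b * (y.2.1 - z₀.2.1),
      fun k => z₀.2.2 k + m k * (y.2.2 k - z₀.2.2 k))
  have hp : ContDiff ℝ ∞ p := by fun_prop
  have hpP : ∀ z, trunc N (P z) = p (trunc N z) := fun _ => rfl
  set Θ : Jet → ℝ := fun z => F (trunc N (P z)) with hΘ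
  have hΘd : IsDiffFun Set.univ Θ :=
    ⟨N, fun y => F (p y), (hF.comp hp).contDiffOn, fun _ _ => rfl⟩
  have hline : ∀ z v (s : ℝ), P (z + s • v) = P z + s • mask a b m v := by
    intro z v s
    simp only [hP]
    rw [add_sub_right_comm, map_add, map_smul, add_assoc]
  have hΘl : ∀ z v, lineDeriv ℝ Θ z v = lineDeriv ℝ (fun z => F (trunc N z)) (P z) (mask a b m v) := by
    intro z v
    simp only [lineDeriv, hΘ, hline]
  -- Both `z` and `P z` lie in the convex `W₀`, so the segment between them does too, and at `P z`
  -- the globalized function agrees with the original one.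
  refine ⟨W₀ ∩ (P ⁻¹' W₀ ∩ P ⁻¹' (trunc N ⁻¹' O)), ?_, ?_, fun z hz => hWV hz.1, Θ,
    hΘd.mono_set (Set.subset_univ _), ?_, ?_⟩
  · exact hW₀.inter ((hW₀.preimage hPc).inter ((hOo.preimage (continuous_trunc N)).preimage hPc))
  · refine ⟨hz₀W, ?_, ?_⟩
    · simpa [hP0] using hz₀W
    · simpa [hP0] using hOz
  · rintro z ⟨hz1, hz2, hz3⟩
    rw [hΘl, he, (hasLineDerivAt_of_eq isOpen_univ (n := N) (g := F) hF.contDiffOn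
      (fun _ _ => rfl) (Set.mem_univ (P z)) e).lineDeriv, hFe, hO _ hz3, ← hfg _ (hWV hz2)]
    refine eq_of_lineDeriv_eq_zero hW₀ hW₀c (hf.mono_set hWV) hz1 hz2 fun y hy => ?_
    have : P z - z = -1 • ((z - z₀) - mask a b m (z - z₀)) := by
      simp only [hP]; module
    rw [this]
    have h1 := (hf.hasLineDerivAt hV (hWV hy) ((z - z₀) - mask a b m (z - z₀))).smul (-1)
    rw [h0 y (hWV hy)] at h1
    simpa using h1.lineDeriv
  · intro v hv z _
    rw [hΘl, hv]
    simp [lineDeriv]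

theorem lineDeriv_eq_zero_of_partial (hV : IsOpen V) {f : Jet → ℝ} (hf : IsDiffFun V f) {z : Jet}
    (hz : z ∈ V) (v : Jet) (hT : v.1 * partialT f z = 0) (hX : v.2.1 * partialX f z = 0)
    (hU : ∀ k, v.2.2 k * partialU k f z = 0) : lineDeriv ℝ f z v = 0 := by
  obtain ⟨n, hn⟩ := hf
  rw [lineDeriv_eq_sum hV hn hz, hT, hX, Finset.sum_eq_zero fun k _ => hU k]
  simp

theorem Dx_eq_partialX_of_partialU_eq_zero {f : Jet → ℝ} {z : Jet}
    (hu : ∀ k, partialU k f z = 0) : Dx f z = partialX f z := by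
  simp [Dx, hu]

/-- A density with vanishing variational derivative is locally a total derivative. -/
theorem exists_local_potential_of_bound (n : ℕ) : ∀ {V : Set Jet}, IsOpen V → ∀ {f : Jet → ℝ},
    IsDiffFun V f → (∀ k, n ≤ k → ∀ z ∈ V, partialU k f z = 0) →
    (∀ z ∈ V, varDeriv f z = 0) → ∀ z₀ ∈ V, ∃ W : Set Jet, IsOpen W ∧ z₀ ∈ W ∧ W ⊆ V ∧
      ∃ Θ : Jet → ℝ, IsDiffFun W Θ ∧ ∀ z ∈ W, f z = Dx Θ z := by
  induction n with
  | zero =>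
    intro V hV f hf h0 _ z₀ hz₀
    have hu := fun k => h0 k (Nat.zero_le k)
    -- No `u_k` occurs in `f`: integrate in `x`, keeping `t` and `x` only.
    obtain ⟨W, hW, hzW, hWV, Θ, hΘ, h1, h2⟩ := exists_local_antiderivative hV hf hz₀ 1 1 0
      (fun z hz v => lineDeriv_eq_zero_of_partial hV hf hz _ (by simp [mask_apply])
        (by simp [mask_apply]) fun k => by rw [hu k z hz, mul_zero]) eX
      (by refine Prod.ext ?_ (Prod.ext ?_ (funext fun k => ?_)) <;> simp [mask_apply, eX])
      (N₀ := 0) (fun N _ h => by simpa [trunc, eX] using congrArg (fun p => p.2.1) h)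
    refine ⟨W, hW, hzW, hWV, Θ, hΘ, fun z hz => ?_⟩
    rw [Dx_eq_partialX_of_partialU_eq_zero, partialX_eq, h1 z hz]
    intro k
    rw [partialU_eq]
    refine h2 _ ?_ z hz
    refine Prod.ext ?_ (Prod.ext ?_ (funext fun k => ?_)) <;> simp [mask_apply, eU]
  | succ n ih =>
    intro V hV f hf h0 hE z₀ hz₀
    -- The `u_{2n}`-derivative of `δf/δu` is `±∂²f/∂u_n²`, so `f` is locally affine in its top
    -- variable.
    have hz2 : ∀ z ∈ V, partialU n (partialU n f) z = 0 := by
      intro z hz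
      have h1 := partialU_varDeriv_top hV hf (m := n) (fun k hk => h0 k hk) hz
      rw [partialU_congr hV (n + n) hE hz, partialU_zero] at h1
      exact (mul_eq_zero.mp h1.symm).resolve_left (pow_ne_zero _ (by norm_num))
    rcases n with _ | n
    · have hz1 : ∀ z ∈ V, partialU 0 f z = 0 := by
        intro z hz
        rw [← hE z hz, varDeriv_eq_sum hV h0 hz]
        simp
      refine ih hV hf (fun k _ => ?_) hE z₀ hz₀
      rcases k with _ | k
      · exact hz1
      · exact h0 _ (by omega)
    · have ha := hf.partialU hV (n + 1)
      have hau : ∀ k, n < k → ∀ z ∈ V, partialU k (partialU (n + 1) f) z = 0 := by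
        intro k hk z hz
        rcases Nat.lt_or_ge (n + 1) k with h | h
        · rw [partialU_eq, lineDeriv_congr_on hV (fun y _ => partialU_eq (n + 1) f y) hz,
            lineDeriv_lineDeriv_comm hV hf hz,
            ← lineDeriv_congr_on hV (fun y _ => partialU_eq k f y) hz,
            lineDeriv_congr_on hV (h0 k h) hz, lineDeriv_const_on]
        · obtain rfl : k = n + 1 := by omega
          exact hz2 z hz
      -- The coefficient of `u_{n+1}` in `f` involves only `t, x, u₀, …, u_n`. Integrate it in `u_n`
      -- to get `Θ` of order at most `n`; then `D_x Θ` has the same coefficient at `u_{n+1}`, and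
      -- subtracting it from `f` lowers the order.
      obtain ⟨W, hW, hzW, hWV, Θ, hΘ, h1, h2⟩ := exists_local_antiderivative hV ha hz₀ 1 1
        (fun k => if k ≤ n then 1 else 0)
        (fun z hz v => lineDeriv_eq_zero_of_partial hV ha hz _ (by simp [mask_apply])
          (by simp [mask_apply]) fun k => by
            by_cases h : k ≤ n
            · simp [mask_apply, h]
            · rw [hau k (by omega) z hz, mul_zero]) (eU n)
        (by
          refine Prod.ext ?_ (Prod.ext ?_ (funext fun k => ?_)) <;>
            simp +contextual [mask_apply, eU, Pi.single_apply])
        (N₀ := n) (fun N hN h => by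
          have h' := congrArg
            (fun p : ℝ × ℝ × (Fin (N + 1) → ℝ) => p.2.2 ⟨n, Nat.lt_succ_of_le hN⟩) h
          change (Pi.single n (1 : ℝ) : ℕ → ℝ) n = 0 at h'
          simp at h')
      have hΘu : ∀ k, n < k → ∀ z ∈ W, partialU k Θ z = 0 := by
        intro k hk z hz
        rw [partialU_eq]
        refine h2 _ ?_ z hz
        refine Prod.ext ?_ (Prod.ext ?_ (funext fun j => ?_))
        · simp [mask_apply, eU]
        · simp [mask_apply, eU]
        · by_cases hj : j ≤ n
          · simp [mask_apply, eU, show j ≠ k by omega]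
          · simp [mask_apply, hj]
      have hfW := hf.mono_set hWV
      have hDΘ := hΘ.Dx hW
      have hsub := hfW.sub hDΘ
      obtain ⟨W', hW', hzW', hWW', Θ', hΘ', h3⟩ := ih hW hsub
        (by
          intro k hk z hz
          obtain ⟨j, rfl⟩ : ∃ j, k = j + 1 := ⟨k - 1, by omega⟩
          have e1 : partialU (j + 1) (fun z => f z - Dx Θ z) z =
              partialU (j + 1) f z - partialU (j + 1) (Dx Θ) z := by
            simp only [partialU_eq]
            exact HasDerivAt.deriv (HasDerivAt.sub (hfW.hasLineDerivAt hW hz _)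
              (hDΘ.hasLineDerivAt hW hz _))
          rw [e1, partialU_succ_Dx hW hΘ hz,
            Dx_congr hW (isDiffFun_const W 0) (hΘu (j + 1) (by omega)) hz, Dx_zero, zero_add]
          rcases Nat.eq_or_lt_of_le hk with h | h
          · obtain rfl : n = j := by omega
            rw [partialU_eq n Θ, h1 z hz, sub_self]
          · rw [h0 (j + 1) (by omega) z (hWV hz), hΘu j (by omega) z hz, sub_zero])
        (by
          intro z hz
          have e1 := varDeriv_add hW hsub hDΘ hz
          rw [varDeriv_congr hW hfW (fun y _ => by ring) hz, hE z (hWV hz),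
            varDeriv_Dx hW hΘ hz, add_zero] at e1
          exact e1.symm) z₀ hzW
      refine ⟨W', hW', hzW', hWW'.trans hWV, fun z => Θ z + Θ' z, (hΘ.mono_set hWW').add hΘ',
        fun z hz => ?_⟩
      rw [Dx_add hW' (hΘ.mono_set hWW') hΘ' hz, ← h3 z hz]
      ring

theorem exists_local_potential (hV : IsOpen V) {f : Jet → ℝ} (hf : IsDiffFun V f)
    (hE : ∀ z ∈ V, varDeriv f z = 0) {z₀ : Jet} (hz₀ : z₀ ∈ V) :
    ∃ W : Set Jet, IsOpen W ∧ z₀ ∈ W ∧ W ⊆ V ∧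
      ∃ Θ : Jet → ℝ, IsDiffFun W Θ ∧ ∀ z ∈ W, f z = Dx Θ z := by
  obtain ⟨n, hn⟩ := hf.exists_bound hV
  exact exists_local_potential_of_bound n hV hf hn hE z₀ hz₀

/-- A differential function annihilated by `D_x` depends only on `t`. -/
theorem partial_eq_zero_of_Dx_eq_zero (hV : IsOpen V) {f : Jet → ℝ} (hf : IsDiffFun V f)
    (h : ∀ z ∈ V, Dx f z = 0) :
    (∀ k, ∀ z ∈ V, partialU k f z = 0) ∧ ∀ z ∈ V, partialX f z = 0 := by
  obtain ⟨n, hn⟩ := hf.exists_bound hV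
  have key : ∀ m k, n ≤ k + m → ∀ z ∈ V, partialU k f z = 0 := by
    intro m
    induction m with
    | zero => exact hn
    | succ m ih =>
      intro k hk z hz
      have h1 := partialU_succ_Dx hV hf hz k
      rw [partialU_congr hV (k + 1) h hz, partialU_zero,
        Dx_congr hV (isDiffFun_const V 0) (ih (k + 1) (by omega)) hz, Dx_zero, zero_add] at h1
      exact h1.symm
  have hu : ∀ k, ∀ z ∈ V, partialU k f z = 0 := fun k => key n k (by omega)
  exact ⟨hu, fun z hz => by
    rw [← Dx_eq_partialX_of_partialU_eq_zero fun k => hu k z hz, h z hz]⟩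

/-- A conserved current whose density has vanishing variational derivative is trivial. -/
theorem isTrivialCurrent_of_varDeriv_eq_zero (hV : IsOpen V) {G ρ σ : Jet → ℝ}
    (hG : IsDiffFun V G) (h : IsConservedCurrent G V ρ σ) (hE : ∀ z ∈ V, varDeriv ρ z = 0) :
    IsTrivialCurrent G V ρ σ := by
  obtain ⟨hρ, hσ, hc⟩ := h
  intro z₀ hz₀
  obtain ⟨W, hW, hzW, hWV, Θ, hΘ, h1⟩ := exists_local_potential hV hρ hE hz₀
  have hGW := hG.mono_set hWV
  have hT := IsDiffFun.DtBar hW hGW hΘ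
  have hs := hσ.mono_set hWV
  have hh := hs.add hT
  -- The potential of the density fixes the flux up to a function of `t` alone.
  have h2 : ∀ z ∈ W, Dx (fun z => σ z + DtBar G Θ z) z = 0 := by
    intro z hz
    rw [Dx_add hW hs hT hz, ← DtBar_Dx hW hGW hΘ hz, ← hc z (hWV hz), add_comm,
      DtBar_eq hW G (hΘ.Dx hW) hz, DtBar_eq hW G (hρ.mono_set hWV) hz,
      lineDeriv_congr_on hW h1 hz]
  obtain ⟨hu, hx⟩ := partial_eq_zero_of_Dx_eq_zero hW hh h2
  -- A primitive `K(t)` of that function is subtracted from `Θ`: this corrects the flux and leaves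
  -- `D_x Θ` unchanged.
  obtain ⟨W', hW', hzW', hWW', K, hK, h3, h4⟩ := exists_local_antiderivative hW hh hzW 1 0 0
    (fun z hz v => lineDeriv_eq_zero_of_partial hW hh hz _ (by simp [mask_apply])
      (by rw [hx z hz, mul_zero]) fun k => by rw [hu k z hz, mul_zero]) eT
    (by refine Prod.ext ?_ (Prod.ext ?_ (funext fun k => ?_)) <;> simp [mask_apply, eT])
    (N₀ := 0) (fun N _ h => by simpa [trunc, eT] using congrArg (fun p => p.1) h)
  have hKu : ∀ k, ∀ z ∈ W', partialU k K z = 0 := fun k z hz => by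
    rw [partialU_eq]
    refine h4 _ ?_ z hz
    refine Prod.ext ?_ (Prod.ext ?_ (funext fun k => ?_)) <;> simp [mask_apply, eU]
  have hKx : ∀ z ∈ W', partialX K z = 0 := fun z hz => by
    rw [partialX_eq]
    refine h4 _ ?_ z hz
    refine Prod.ext ?_ (Prod.ext ?_ (funext fun k => ?_)) <;> simp [mask_apply, eX]
  refine ⟨W', hW', hzW', hWW'.trans hWV, fun z => Θ z + -K z,
    (hΘ.mono_set hWW').add hK.neg, fun z hz => ?_⟩
  have hneg : ∀ v, lineDeriv ℝ (fun z => -K z) z v = -lineDeriv ℝ K z v := fun v =>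
    HasDerivAt.deriv (HasDerivAt.neg (hK.hasLineDerivAt hW' hz v))
  constructor
  · rw [Dx_add hW' (hΘ.mono_set hWW') hK.neg hz, h1 z (hWW' hz), Dx_eq hW' hK.neg hz, hneg,
      ← Dx_eq hW' hK hz, Dx_eq_partialX_of_partialU_eq_zero fun k => hKu k z hz, hKx z hz]
    simp
  · have : DtBar G K z = σ z + DtBar G Θ z := by
      rw [← h3 z hz, ← partialT_eq, DtBar]
      simp [hKu _ z hz]
    rw [DtBar_add hW' G (hΘ.mono_set hWW') hK.neg hz, DtBar_eq hW' G hK.neg hz, hneg,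
      ← DtBar_eq hW' G hK hz, this]
    ring

end Exactness

/-! ### Homogeneous and particular solutions modulo total derivatives -/

section DarbouxForm

variable {A : Type*} [CommRing A] [Algebra ℝ A] (D : Derivation ℝ A A)

/-- The contribution of the `t`-derivatives of the densities to the right-hand side. -/
def correction {n : ℕ} (l : Fin (n + 1) → A) (w : A) (w' : Fin (n + 1) → A)
    (τ : Fin (n + 1) → A) : A :=
  ∑ s : Fin (n + 1), (-1) ^ (n - (s : ℕ)) *
    opAdj D (dtCoeff D (fun j : Fin n => l (s.succAbove j)) (w' s))
      ((wrMatrix D (fun j : Fin n => l (s.succAbove j))).det * w * τ s)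

theorem mul_opAdj_dtCoeff_mem {k : ℕ} (l : Fin k → A) (w H : A) (r : Fin k) :
    l r * opAdj D (dtCoeff D l w) H ∈ D.toLinearMap.range := by
  simpa [sum_dtCoeff_mul_self] using opAdj_sub_mem D (dtCoeff D l w) (l r) H

/-- Adjointness moves the operator omitting `l s` onto `l r`. The result is zero for `r ≠ s`; for `r
= s` it is a quotient of Wronskians that cancels the prefactor, up to the sign `(-1)^(n - s)`. -/
theorem mul_correction_sub_mem {n : ℕ} (l : Fin (n + 1) → A) {w : A}
    (hw : (wrMatrix D l).det * w = 1) {w' : Fin (n + 1) → A}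
    (hw' : ∀ s, (wrMatrix D (fun j : Fin n => l (s.succAbove j))).det * w' s = 1)
    (τ : Fin (n + 1) → A) (r : Fin (n + 1)) :
    l r * correction D l w w' τ - τ r ∈ D.toLinearMap.range := by
  have key : ∀ s : Fin (n + 1), l r * ((-1) ^ (n - (s : ℕ)) *
      opAdj D (dtCoeff D (fun j : Fin n => l (s.succAbove j)) (w' s))
        ((wrMatrix D (fun j : Fin n => l (s.succAbove j))).det * w * τ s)) -
      (if s = r then τ r else 0) ∈ D.toLinearMap.range := by
    intro s
    have h1 := opAdj_sub_mem D (dtCoeff D (fun j : Fin n => l (s.succAbove j)) (w' s)) (l r)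
      ((wrMatrix D (fun j : Fin n => l (s.succAbove j))).det * w * τ s)
    by_cases hs : s = r
    · subst hs
      rw [if_pos rfl]
      rw [sum_dtCoeff_mul, det_snoc_succAbove] at h1
      rcases neg_one_pow_eq_or A (n - (s : ℕ)) with e | e <;> rw [e] at h1 ⊢
      · convert h1 using 1
        linear_combination τ s * hw' s + τ s * ((wrMatrix D (fun j : Fin n => l (s.succAbove j))).det * w' s) * hw
      · convert neg_mem h1 using 1
        linear_combination τ s * hw' s + τ s * ((wrMatrix D (fun j : Fin n => l (s.succAbove j))).det * w' s) * hw
    · rw [if_neg hs, sub_zero]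
      obtain ⟨j, rfl⟩ := Fin.exists_succAbove_eq (Ne.symm hs)
      have h2 := mul_opAdj_dtCoeff_mem D (fun j : Fin n => l (s.succAbove j)) (w' s)
        ((wrMatrix D (fun j : Fin n => l (s.succAbove j))).det * w * τ s) j
      rcases neg_one_pow_eq_or A (n - (s : ℕ)) with e | e <;> rw [e]
      · simpa using h2
      · simpa using neg_mem h2
  have := sum_mem (t := Finset.univ) fun s _ => key s
  simpa [Finset.sum_sub_distrib, correction, Finset.mul_sum] using this

end DarbouxForm

/-! ### Independence over the kernel of `D_x` -/

section LinearIndependence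

variable {V : Set Jet}

theorem eq_zero_of_sum_mul_varDeriv (hV : IsOpen V) {k : ℕ}
    {f : Fin k → Jet → ℝ} (hf : ∀ s, IsDiffFun V (f s)) (hW : ∀ z ∈ V, wronskian f z ≠ 0)
    (c : Fin k → Jet → ℝ) (hc : ∀ s, IsDiffFun V (c s)) (hD : ∀ s, ∀ z ∈ V, Dx (c s) z = 0)
    (h : ∀ z ∈ V, ∑ s, c s z * f s z = 0) : ∀ s, ∀ z ∈ V, c s z = 0 := by
  choose l hl using fun s => exists_rep (hf s)
  choose d hd using fun s => exists_rep (hc s)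
  obtain ⟨w, hw, -⟩ := (Rep.wronskian hV hl).exists_inv hW
  have := eq_zero_of_sum_mul_eq_zero (totalD hV) l hw d
    (fun j => ((hd j).totalD hV).eq rep_zero (hD j))
    ((Rep.sum Finset.univ fun s => (hd s).mul (hl s)).eq rep_zero h)
  intro s
  exact (hd s).eqOn rep_zero (congrFun this s)

end LinearIndependence

/-! ### The normal form of the equation -/

section NormalForm

variable {V : Set Jet} {n : ℕ}

/-- The right-hand side of the evolution equation with prescribed densities. -/
noncomputable def normalForm (lam ρ : Fin (n + 1) → Jet → ℝ) (H : Jet → ℝ) (z : Jet) : ℝ :=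
  darbouxAdjoint lam H z -
    ∑ s : Fin (n + 1), (-1) ^ (n - (s : ℕ)) *
      darbouxAdjoint (fun j : Fin n => lam (s.succAbove j))
        (fun w => wronskian (fun j : Fin n => lam (s.succAbove j)) w /
          wronskian lam w * partialT (ρ s) w) z

theorem Rep.normalForm (hV : IsOpen V) {lam ρ : Fin (n + 1) → Jet → ℝ} {H : Jet → ℝ}
    {l τ w' : Fin (n + 1) → diffAlg V} {w a : diffAlg V} (hl : ∀ s, Rep (l s) (lam s))
    (hτ : ∀ s, Rep (τ s) (partialT (ρ s)))
    (hw : Rep w (fun z => (EvolutionCL.wronskian lam z)⁻¹))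
    (hw' : ∀ s, Rep (w' s)
      (fun z => (EvolutionCL.wronskian (fun j : Fin n => lam (s.succAbove j)) z)⁻¹))
    (ha : Rep a H) :
    Rep (opAdj (EvolutionCL.totalD hV) (dtCoeff (EvolutionCL.totalD hV) l w) a -
      correction (EvolutionCL.totalD hV) l w w' τ) (normalForm lam ρ H) :=
  (Rep.darbouxAdjoint hV hl hw ha).sub (Rep.sum _ fun s => (rep_neg_one_pow _).mul
    (Rep.darbouxAdjoint hV (fun j => hl (s.succAbove j)) (hw' s)
      (((Rep.wronskian hV fun j : Fin n => hl (s.succAbove j)).mul hw).mul (hτ s))))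

/-- Adding the correction to `G` makes the conditions homogeneous, and variation of parameters
applies. -/
theorem exists_normalForm_of_conservedCurrent (hV : IsOpen V) {G : Jet → ℝ} (hG : IsDiffFun V G)
    {ρ σ : Fin (n + 1) → Jet → ℝ} (hσ : ∀ s, IsConservedCurrent G V (ρ s) (σ s))
    (hW : ∀ z ∈ V, wronskian (fun s => varDeriv (ρ s)) z ≠ 0)
    (hW' : ∀ s : Fin (n + 1), ∀ z ∈ V,
      wronskian (fun j : Fin n => varDeriv (ρ (s.succAbove j))) z ≠ 0) :
    ∃ H : Jet → ℝ, IsDiffFun V H ∧ ∀ z ∈ V, G z = normalForm (fun s => varDeriv (ρ s)) ρ H z := by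
  choose l hl using fun s => exists_rep ((hσ s).1.varDeriv hV)
  choose τ hτ using fun s => exists_rep ((hσ s).1.partialT hV)
  obtain ⟨g, hg⟩ := exists_rep hG
  obtain ⟨w, hw, hwr⟩ := (Rep.wronskian hV hl).exists_inv hW
  choose w' hw' hwr' using fun s : Fin (n + 1) =>
    (Rep.wronskian hV fun j : Fin n => hl (s.succAbove j)).exists_inv (hW' s)
  have hΦ : ∀ r, ∃ Φ, l r * (g + correction (totalD hV) l w w' τ) = totalD hV Φ := by
    intro r
    obtain ⟨σ₀, hσ₀, hρ₀⟩ := exists_DtBar_eq hV hG (hσ r).1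
    obtain ⟨c, hc⟩ := mul_correction_sub_mem (totalD hV) l hw hw' τ r
    obtain ⟨b₀, hb₀⟩ := exists_rep hσ₀
    obtain ⟨b, hb⟩ := exists_rep (hσ r).2.1
    have h1 : τ r + l r * g + totalD hV b₀ + totalD hV b = 0 := by
      refine ((((hτ r).add ((hl r).mul hg)).add (hb₀.totalD hV)).add (hb.totalD hV)).eq
        rep_zero fun z hz => ?_
      rw [← hρ₀ z hz, (hσ r).2.2 z hz]
    refine ⟨c - b₀ - b, ?_⟩
    rw [map_sub, map_sub, show totalD hV c = _ from hc]
    linear_combination h1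
  choose Φ hΦ using hΦ
  obtain ⟨H, hH⟩ := exists_opAdj_dtCoeff_eq (totalD hV) l hw _ Φ hΦ
  exact ⟨extend H, (rep_extend H).isDiffFun,
    hg.eqOn (Rep.normalForm hV hl hτ hwr hwr' (rep_extend H)) (by rw [hH, add_sub_cancel_right])⟩

theorem exists_conservedCurrent_of_normalForm (hV : IsOpen V) {G H : Jet → ℝ}
    (hG : IsDiffFun V G) (hH : IsDiffFun V H)
    {ρ : Fin (n + 1) → Jet → ℝ} (hρ : ∀ s, IsDiffFun V (ρ s))
    (hW : ∀ z ∈ V, wronskian (fun s => varDeriv (ρ s)) z ≠ 0)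
    (hW' : ∀ s : Fin (n + 1), ∀ z ∈ V,
      wronskian (fun j : Fin n => varDeriv (ρ (s.succAbove j))) z ≠ 0)
    (hGH : ∀ z ∈ V, G z = normalForm (fun s => varDeriv (ρ s)) ρ H z) (r : Fin (n + 1)) :
    ∃ σ, IsConservedCurrent G V (ρ r) σ := by
  choose l hl using fun s => exists_rep ((hρ s).varDeriv hV)
  choose τ hτ using fun s => exists_rep ((hρ s).partialT hV)
  obtain ⟨g, hg⟩ := exists_rep hG
  obtain ⟨a, ha⟩ := exists_rep hH
  obtain ⟨w, hw, hwr⟩ := (Rep.wronskian hV hl).exists_inv hW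
  choose w' hw' hwr' using fun s : Fin (n + 1) =>
    (Rep.wronskian hV fun j : Fin n => hl (s.succAbove j)).exists_inv (hW' s)
  obtain ⟨σ₀, hσ₀, hρ₀⟩ := exists_DtBar_eq hV hG (hρ r)
  have hga := hg.eq (Rep.normalForm hV hl hτ hwr hwr' ha) hGH
  obtain ⟨c, hc⟩ : ∃ c, l r * g + τ r = totalD hV c := by
    obtain ⟨c, hc⟩ := mul_correction_sub_mem (totalD hV) l hw hw' τ r
    obtain ⟨d, hd⟩ := mul_opAdj_dtCoeff_mem (totalD hV) l w a r
    refine ⟨d - c, ?_⟩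
    rw [map_sub, show totalD hV c = _ from hc, show totalD hV d = _ from hd, hga]
    ring
  have hsum := hσ₀.add (rep_extend c).isDiffFun
  refine ⟨fun z => -(σ₀ z + extend c z), hρ r, hsum.neg, fun z hz => ?_⟩
  have h1 := (((hl r).mul hg).add (hτ r)).eqOn ((rep_extend c).totalD hV) hc z hz
  have h2 : Dx (fun z => -(σ₀ z + extend c z)) z = -(Dx σ₀ z + Dx (extend c) z) := by
    rw [← Dx_add hV hσ₀ (rep_extend c).isDiffFun hz, Dx_eq hV hsum.neg hz, Dx_eq hV hsum hz]
    exact HasDerivAt.deriv (HasDerivAt.neg (hsum.hasLineDerivAt hV hz _))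
  rw [h2, hρ₀ z hz]
  linarith

theorem Dx_const (c : ℝ) (z : Jet) : Dx (fun _ => c) z = 0 := by
  rw [Dx_eq isOpen_univ (isDiffFun_const _ c) (Set.mem_univ z), lineDeriv_const_on]

theorem partialU_const (k : ℕ) (c : ℝ) (z : Jet) : partialU k (fun _ => c) z = 0 := by
  rw [partialU_eq, lineDeriv_const_on]

/-- The variational derivative kills `D_x Θ`, leaving a constant-coefficient relation between
characteristics near one point. On the empty set every current would be trivial. -/
theorem eq_zero_of_isTrivialCurrent {k : ℕ} (hne : V.Nonempty) {G σ : Jet → ℝ}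
    {ρ : Fin k → Jet → ℝ} (hρ : ∀ s, IsDiffFun V (ρ s))
    (hW : ∀ z ∈ V, wronskian (fun s => varDeriv (ρ s)) z ≠ 0) (d : Fin k → ℝ)
    (hd : IsTrivialCurrent G V (fun z => ∑ s, d s * ρ s z) σ) : d = 0 := by
  obtain ⟨z₀, hz₀⟩ := hne
  obtain ⟨W, hWo, hzW, hWV, Θ, hΘ, h1⟩ := hd z₀ hz₀
  have hρW := fun s => (hρ s).mono_set hWV
  have h2 : ∀ z ∈ W, ∑ s, d s * varDeriv (ρ s) z = 0 := by
    intro z hz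
    have h3 := varDeriv_sum_mul hWo Finset.univ (c := fun s _ => d s)
      (fun s => isDiffFun_const W (d s)) hρW (fun s z _ => Dx_const _ z)
      (fun s k z _ => partialU_const k _ z) hz
    rw [varDeriv_congr hWo (hΘ.Dx hWo) (fun y hy => (h1 y hy).1) hz, varDeriv_Dx hWo hΘ hz] at h3
    exact h3.symm
  ext s
  exact eq_zero_of_sum_mul_varDeriv hWo (fun s => (hρW s).varDeriv hWo)
    (fun z hz => hW z (hWV hz)) (fun s _ => d s) (fun s => isDiffFun_const W (d s))
    (fun s z _ => Dx_const _ z) h2 s z₀ hzW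

/-- On the regular set, the evolution equations with given densities of linearly independent
conservation laws are those in normal form. -/
theorem admitsLinIndepCL_iff (hV : IsOpen V) (hne : V.Nonempty)
    {G : Jet → ℝ} (hG : IsDiffFun V G) {ρ : Fin (n + 1) → Jet → ℝ} (hρ : ∀ s, IsDiffFun V (ρ s))
    (hW : ∀ z ∈ V, wronskian (fun s => varDeriv (ρ s)) z ≠ 0)
    (hW' : ∀ s : Fin (n + 1), ∀ z ∈ V,
      wronskian (fun j : Fin n => varDeriv (ρ (s.succAbove j))) z ≠ 0) :
    AdmitsLinIndepCL G V ρ ↔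
      ∃ H : Jet → ℝ, IsDiffFun V H ∧
        ∀ z ∈ V, G z = normalForm (fun s => varDeriv (ρ s)) ρ H z := by
  constructor
  · rintro ⟨σ, hσ, -⟩
    exact exists_normalForm_of_conservedCurrent hV hG hσ hW hW'
  · rintro ⟨H, hH, hGH⟩
    choose σ hσ using exists_conservedCurrent_of_normalForm hV hG hH hρ hW hW' hGH
    exact ⟨σ, hσ, fun d hd => eq_zero_of_isTrivialCurrent hne hρ hW d hd⟩

end NormalForm

/-! ### Density of the regular set -/

section Density

variable {V : Set Jet}

theorem IsDiffFun.continuousOn {f : Jet → ℝ} (hf : IsDiffFun V f) : ContinuousOn f V := by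
  obtain ⟨n, g, hg, hfg⟩ := hf
  exact (hg.continuousOn.comp (continuous_trunc n).continuousOn (Set.mapsTo_image _ _)).congr hfg

theorem IsDiffFun.isOpen_ne_zero (hV : IsOpen V) {f : Jet → ℝ} (hf : IsDiffFun V f) :
    IsOpen {z | z ∈ V ∧ f z ≠ 0} :=
  hf.continuousOn.isOpen_inter_preimage hV isOpen_ne

theorem IsDiffFun.wronskian (hV : IsOpen V) {k : ℕ} {f : Fin k → Jet → ℝ}
    (hf : ∀ s, IsDiffFun V (f s)) : IsDiffFun V (wronskian f) := by
  choose l hl using fun s => exists_rep (hf s)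
  exact (Rep.wronskian hV hl).isDiffFun

theorem lineDeriv_sum_on (hV : IsOpen V) {k : ℕ} {f : Fin k → Jet → ℝ}
    (hf : ∀ s, IsDiffFun V (f s)) {z : Jet} (hz : z ∈ V) (v : Jet) :
    lineDeriv ℝ (fun z => ∑ s, f s z) z v = ∑ s, lineDeriv ℝ (f s) z v :=
  HasDerivAt.deriv (HasDerivAt.fun_sum fun s _ => (hf s).hasLineDerivAt hV hz v)

theorem Dx_sum_mul (hV : IsOpen V) {k : ℕ} {c f : Fin k → Jet → ℝ}
    (hc : ∀ s, IsDiffFun V (c s)) (hf : ∀ s, IsDiffFun V (f s))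
    (hD : ∀ s, ∀ z ∈ V, Dx (c s) z = 0) {z : Jet} (hz : z ∈ V) :
    Dx (fun z => ∑ s, c s z * f s z) z = ∑ s, c s z * Dx (f s) z := by
  rw [Dx_eq hV (IsDiffFun.sum _ fun s => (hc s).mul (hf s)) hz,
    lineDeriv_sum_on hV (fun s => (hc s).mul (hf s)) hz]
  refine Finset.sum_congr rfl fun s _ => ?_
  rw [← Dx_eq hV ((hc s).mul (hf s)) hz, Dx_mul hV (hc s) (hf s) hz, hD s z hz]
  ring

theorem DtBar_sum_mul (hV : IsOpen V) (G : Jet → ℝ) {k : ℕ} {c f : Fin k → Jet → ℝ}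
    (hc : ∀ s, IsDiffFun V (c s)) (hf : ∀ s, IsDiffFun V (f s))
    (hD : ∀ s, ∀ z ∈ V, Dx (c s) z = 0) {z : Jet} (hz : z ∈ V) :
    DtBar G (fun z => ∑ s, c s z * f s z) z =
      ∑ s, c s z * DtBar G (f s) z + ∑ s, partialT (c s) z * f s z := by
  rw [DtBar_eq hV G (IsDiffFun.sum _ fun s => (hc s).mul (hf s)) hz,
    lineDeriv_sum_on hV (fun s => (hc s).mul (hf s)) hz, ← Finset.sum_add_distrib]
  refine Finset.sum_congr rfl fun s _ => ?_
  have : DtBar G (c s) z = partialT (c s) z := by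
    simp [DtBar, (partial_eq_zero_of_Dx_eq_zero hV (hc s) (hD s)).1 _ z hz]
  rw [← DtBar_eq hV G ((hc s).mul (hf s)) hz, DtBar_mul hV G (hc s) (hf s) hz, this]
  ring

/-- A linear relation between characteristics, with coefficients depending only on `t`, can be
differentiated with respect to `t`. -/
theorem sum_partialT_mul_varDeriv_eq_zero (hV : IsOpen V) {G : Jet → ℝ} (hG : IsDiffFun V G)
    {k : ℕ} {ρ σ c : Fin k → Jet → ℝ} (hσ : ∀ s, IsConservedCurrent G V (ρ s) (σ s))
    (hc : ∀ s, IsDiffFun V (c s)) (hD : ∀ s, ∀ z ∈ V, Dx (c s) z = 0)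
    (h : ∀ z ∈ V, ∑ s, c s z * varDeriv (ρ s) z = 0) {z₀ : Jet} (hz₀ : z₀ ∈ V) :
    ∑ s, partialT (c s) z₀ * varDeriv (ρ s) z₀ = 0 := by
  have hu := fun s => (partial_eq_zero_of_Dx_eq_zero hV (hc s) (hD s)).1
  obtain ⟨W, hW, hzW, hWV, Θ, hΘ, h1⟩ := exists_local_potential hV
    (IsDiffFun.sum Finset.univ fun s => (hc s).mul (hσ s).1)
    (fun z hz => (varDeriv_sum_mul hV Finset.univ hc (fun s => (hσ s).1) hD hu hz).trans (h z hz))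
    hz₀
  have hGW := hG.mono_set hWV
  have hcW := fun s => (hc s).mono_set hWV
  have hρW := fun s => (hσ s).1.mono_set hWV
  have hσW := fun s => (hσ s).2.1.mono_set hWV
  have hDW := fun s z (hz : z ∈ W) => hD s z (hWV hz)
  have hT := IsDiffFun.DtBar hW hGW hΘ
  have hS : IsDiffFun W (fun z => ∑ s, c s z * σ s z) :=
    IsDiffFun.sum Finset.univ fun s => (hcW s).mul (hσW s)
  -- Locally `∑ c ρ = D_x Θ`. Applying `D̄_t` and replacing `D̄_t ρ` by `-D_x σ` shows that `∑ (∂_t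
  -- c) ρ` is a total derivative too.
  have h2 : ∀ z ∈ W, ∑ s, partialT (c s) z * ρ s z =
      Dx (fun z => DtBar G Θ z + ∑ s, c s z * σ s z) z := by
    intro z hz
    have e1 := DtBar_sum_mul hW G hcW hρW hDW hz
    have e2 : DtBar G (fun z => ∑ s, c s z * ρ s z) z = Dx (DtBar G Θ) z := by
      rw [← DtBar_Dx hW hGW hΘ hz, DtBar_eq hW G (hΘ.Dx hW) hz,
        DtBar_eq hW G (IsDiffFun.sum _ fun s => (hcW s).mul (hρW s)) hz,
        lineDeriv_congr_on hW h1 hz]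
    have e3 : ∑ s, c s z * DtBar G (ρ s) z + ∑ s, c s z * Dx (σ s) z = 0 := by
      rw [← Finset.sum_add_distrib]
      refine Finset.sum_eq_zero fun s _ => ?_
      rw [← mul_add, (hσ s).2.2 z (hWV hz), mul_zero]
    rw [Dx_add hW hT hS hz, Dx_sum_mul hW hcW hσW hDW hz]
    linarith
  have hcT := fun s => (hcW s).partialT hW
  have hDT : ∀ s, ∀ z ∈ W, Dx (partialT (c s)) z = 0 := fun s z hz => by
    rw [← partialT_Dx hW (hcW s) hz, partialT_eq, lineDeriv_congr_on hW (hDW s) hz,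
      lineDeriv_const_on]
  rw [← varDeriv_sum_mul hW Finset.univ hcT hρW hDT
    (fun s => (partial_eq_zero_of_Dx_eq_zero hW (hcT s) (hDT s)).1) hzW,
    varDeriv_congr hW ((hT.add hS).Dx hW) h2 hzW, varDeriv_Dx hW (hT.add hS) hzW]

/-- Coefficients on a subfamily are extended by zero. -/
theorem AdmitsLinIndepCL.comp_injective {p q : ℕ} {G : Jet → ℝ} {ρ : Fin p → Jet → ℝ}
    (h : AdmitsLinIndepCL G V ρ) {e : Fin q → Fin p} (he : Function.Injective e) :
    AdmitsLinIndepCL G V (fun j => ρ (e j)) := by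
  obtain ⟨σ, hσ, hi⟩ := h
  refine ⟨fun j => σ (e j), fun j => hσ (e j), fun c hc => ?_⟩
  have hsum : ∀ f : Fin p → ℝ, ∑ s, Function.extend e c 0 s * f s = ∑ j, c j * f (e j) := by
    intro f
    rw [← Finset.sum_subset (Finset.subset_univ (Finset.univ.image e)),
      Finset.sum_image he.injOn]
    · exact Finset.sum_congr rfl fun j _ => by rw [he.extend_apply]
    · intro s _ hs
      rw [Function.extend_apply' _ _ _ fun ⟨j, hj⟩ => hs (by simp [← hj])]
      simp
  have h0 := hi (Function.extend e c 0) (by simpa only [hsum] using hc)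
  ext j
  simpa [he.extend_apply] using congrFun h0 (e j)

/-- A relation between the characteristics with coefficients in the kernel of `D_x`, one of which
is `-1`, while the remaining characteristics have nonvanishing Wronskian, contradicts the linear
independence of conservation laws. -/
theorem not_exists_relation {G : Jet → ℝ} (hV : IsOpen V) (hne : V.Nonempty)
    (hG : IsDiffFun V G) {k : ℕ} {ρ : Fin (k + 1) → Jet → ℝ}
    (h : ∀ W : Set Jet, IsOpen W → W.Nonempty → W ⊆ V → AdmitsLinIndepCL G W ρ)
    (hW : ∀ z ∈ V, wronskian (fun j : Fin k => varDeriv (ρ j.castSucc)) z ≠ 0)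
    (c : Fin k → Jet → ℝ) (hc : ∀ j, IsDiffFun V (c j)) (hD : ∀ j, ∀ z ∈ V, Dx (c j) z = 0) :
    ¬ ∀ z ∈ V, varDeriv (ρ (Fin.last k)) z = ∑ j, c j z * varDeriv (ρ j.castSucc) z := by
  intro hrel
  obtain ⟨σ, hσ, -⟩ := h V hV hne subset_rfl
  have hρ := fun s => (hσ s).1
  let C : Fin (k + 1) → Jet → ℝ := Fin.snoc (α := fun _ => Jet → ℝ) c (fun _ => -1)
  have hCc : ∀ j : Fin k, C j.castSucc = c j := fun j => Fin.snoc_castSucc ..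
  have hCl : C (Fin.last k) = fun _ => -1 := Fin.snoc_last ..
  have hC : ∀ s, IsDiffFun V (C s) := Fin.lastCases (by rw [hCl]; exact isDiffFun_const V _)
    (fun j => by rw [hCc]; exact hc j)
  have hCD : ∀ s, ∀ z ∈ V, Dx (C s) z = 0 := Fin.lastCases (by
    rw [hCl]; exact fun z _ => Dx_const _ z) (fun j => by rw [hCc]; exact hD j)
  have hCrel : ∀ z ∈ V, ∑ s, C s z * varDeriv (ρ s) z = 0 := by
    intro z hz
    rw [Fin.sum_univ_castSucc, hCl, hrel z hz]
    simp only [hCc]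
    ring
  -- Differentiation in `t` removes the constant coefficient `-1`, leaving a relation between
  -- characteristics with nonvanishing Wronskian.
  have hcT : ∀ j, ∀ z ∈ V, partialT (c j) z = 0 := by
    refine eq_zero_of_sum_mul_varDeriv hV (fun j => (hρ j.castSucc).varDeriv hV) hW
      (fun j => partialT (c j)) (fun j => (hc j).partialT hV) (fun j z hz => ?_) fun z hz => ?_
    · rw [← partialT_Dx hV (hc j) hz, partialT_eq, lineDeriv_congr_on hV (hD j) hz,
        lineDeriv_const_on]
    · have := sum_partialT_mul_varDeriv_eq_zero hV hG hσ hC hCD hCrel hz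
      rw [Fin.sum_univ_castSucc, hCl, partialT_eq (fun _ => -1), lineDeriv_const_on] at this
      simpa only [hCc, zero_mul, add_zero] using this
  have hCT : ∀ s, ∀ z ∈ V, partialT (C s) z = 0 := Fin.lastCases (by
    rw [hCl]; exact fun z _ => by rw [partialT_eq, lineDeriv_const_on])
    (fun j => by rw [hCc]; exact hcT j)
  obtain ⟨z₁, hz₁⟩ := hne
  -- The coefficients are constant only on a convex piece, so independence is needed on that smaller
  -- set.
  obtain ⟨W, hWo, hWc, hzW, hWV⟩ := exists_convex_nhds hV hz₁
  have hconst : ∀ s, ∀ z ∈ W, C s z = C s z₁ := by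
    intro s z hz
    have hp := partial_eq_zero_of_Dx_eq_zero hV (hC s) (hCD s)
    refine eq_of_lineDeriv_eq_zero hWo hWc ((hC s).mono_set hWV) hzW hz fun y hy =>
      lineDeriv_eq_zero_of_partial hV (hC s) (hWV hy) _ ?_ ?_ fun k => ?_
    · rw [hCT s y (hWV hy), mul_zero]
    · rw [hp.2 y (hWV hy), mul_zero]
    · rw [hp.1 k y (hWV hy), mul_zero]
  obtain ⟨σ', hσ', hi⟩ := h W hWo ⟨z₁, hzW⟩ hWV
  have hd := fun s => isDiffFun_const W (C s z₁)
  have hdD : ∀ s, ∀ z ∈ W, Dx (fun _ => C s z₁) z = 0 := fun s z _ => Dx_const _ z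
  have hcons : IsConservedCurrent G W (fun z => ∑ s, C s z₁ * ρ s z)
      (fun z => ∑ s, C s z₁ * σ' s z) := by
    refine ⟨IsDiffFun.sum _ fun s => (hd s).mul (hσ' s).1,
      IsDiffFun.sum _ fun s => (hd s).mul (hσ' s).2.1, fun z hz => ?_⟩
    rw [DtBar_sum_mul hWo G hd (fun s => (hσ' s).1) hdD hz,
      Dx_sum_mul hWo hd (fun s => (hσ' s).2.1) hdD hz]
    simp only [partialT_eq, lineDeriv_const_on, zero_mul, Finset.sum_const_zero, add_zero]
    rw [← Finset.sum_add_distrib]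
    refine Finset.sum_eq_zero fun s _ => ?_
    rw [← mul_add, (hσ' s).2.2 z hz, mul_zero]
  have h0 := hi (fun s => C s z₁) (isTrivialCurrent_of_varDeriv_eq_zero hWo (hG.mono_set hWV) hcons
    fun z hz => by
      rw [varDeriv_sum_mul hWo Finset.univ hd (fun s => (hσ' s).1) hdD
        (fun s k z _ => partialU_const k _ z) hz, ← hCrel z (hWV hz)]
      exact Finset.sum_congr rfl fun s _ => by rw [hconst s z hz])
  have := congrFun h0 (Fin.last k)
  simp [hCl] at this

/-- Induction on the number of densities: where the Wronskian without the last characteristic is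
nonzero, vanishing of the full one would give a relation excluded by `not_exists_relation`. -/
theorem exists_wronskian_ne_zero {G : Jet → ℝ} {k : ℕ} : ∀ {V : Set Jet}, IsOpen V → V.Nonempty →
    IsDiffFun V G → ∀ {ρ : Fin k → Jet → ℝ},
    (∀ W : Set Jet, IsOpen W → W.Nonempty → W ⊆ V → AdmitsLinIndepCL G W ρ) →
    ∃ z ∈ V, wronskian (fun s => varDeriv (ρ s)) z ≠ 0 := by
  induction k with
  | zero =>
    intro V _ hne _ ρ _
    obtain ⟨z, hz⟩ := hne
    exact ⟨z, hz, by simp [wronskian]⟩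
  | succ k ih =>
    intro V hV hne hG ρ h
    by_contra! hzero
    obtain ⟨σ, hσ, -⟩ := h V hV hne subset_rfl
    have hl0 := fun s => (hσ s).1.varDeriv hV
    obtain ⟨z₁, hz₁, hwz⟩ := ih hV hne hG (ρ := fun j => ρ j.castSucc) fun W hW hWne hWV =>
      (h W hW hWne hWV).comp_injective (Fin.castSucc_injective k)
    have hO := (IsDiffFun.wronskian hV fun j : Fin k => hl0 j.castSucc).isOpen_ne_zero hV
    set O := {z | z ∈ V ∧ wronskian (fun j : Fin k => varDeriv (ρ j.castSucc)) z ≠ 0} with hOdef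
    have hOV : O ⊆ V := fun z hz => hz.1
    choose l hl using fun s => exists_rep ((hl0 s).mono_set hOV)
    obtain ⟨w, hw, -⟩ := (Rep.wronskian hO fun j : Fin k => hl j.castSucc).exists_inv
      fun z hz => hz.2
    have hfull : (Fin.snoc (α := fun _ => diffAlg O) (fun j : Fin k => l j.castSucc)
        (l (Fin.last k))) = l := Fin.snoc_init_self l
    obtain ⟨c, hcD, hrel⟩ := exists_const_combination (totalD hO) (fun j : Fin k => l j.castSucc)
      (l (Fin.last k)) hw (by
        rw [hfull]
        exact (Rep.wronskian hO hl).eq rep_zero fun z hz => hzero z (hOV hz))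
    exact not_exists_relation hO ⟨z₁, hz₁, hwz⟩ (hG.mono_set hOV)
      (fun W hW hWne hWO => h W hW hWne (hWO.trans hOV)) (fun z hz => hz.2)
      (fun j => extend (c j)) (fun j => (rep_extend (c j)).isDiffFun)
      (fun j => ((rep_extend (c j)).totalD hO).eqOn rep_zero (hcD j))
      ((hl (Fin.last k)).eqOn (Rep.sum _ fun j => (rep_extend (c j)).mul (hl j.castSucc)) hrel)

/-- The regular set is dense if the densities give linearly independent conservation laws on every
nonempty open subset. -/
theorem subset_closure_regularSet {U : Set Jet} (hU : IsOpen U) {n : ℕ} {G : Jet → ℝ}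
    (hG : IsDiffFun U G) {ρ : Fin (n + 1) → Jet → ℝ} (hρ : ∀ s, IsDiffFun U (ρ s))
    (h : ∀ V : Set Jet, IsOpen V → V.Nonempty → V ⊆ U → AdmitsLinIndepCL G V ρ) :
    U ⊆ closure (regularSet U ρ) := by
  have step : ∀ {k : ℕ} (e : Fin k → Fin (n + 1)), Function.Injective e → ∀ V : Set Jet, IsOpen V →
      V.Nonempty → V ⊆ U → ∃ W : Set Jet, IsOpen W ∧ W.Nonempty ∧ W ⊆ V ∧
        ∀ z ∈ W, wronskian (fun j => varDeriv (ρ (e j))) z ≠ 0 := by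
    intro k e he V hV hne hVU
    obtain ⟨z, hz, hwz⟩ := exists_wronskian_ne_zero hV hne (hG.mono_set hVU)
      (ρ := fun j => ρ (e j)) fun W hW hWne hWV =>
        (h W hW hWne (hWV.trans hVU)).comp_injective he
    exact ⟨_, (IsDiffFun.wronskian hV fun j =>
      ((hρ (e j)).mono_set hVU).varDeriv hV).isOpen_ne_zero hV, ⟨z, hz, hwz⟩, fun z hz => hz.1,
      fun z hz => hz.2⟩
  intro z hz
  rw [mem_closure_iff]
  intro O hO hzO
  obtain ⟨V, hV, hne, hVO, hwV⟩ := step id Function.injective_id (O ∩ U) (hO.inter hU) ⟨z, hzO, hz⟩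
    Set.inter_subset_right
  -- The open set is shrunk once for each omitted index.
  have key : ∀ S : Finset (Fin (n + 1)), ∃ W : Set Jet, IsOpen W ∧ W.Nonempty ∧ W ⊆ V ∧
      ∀ s ∈ S, ∀ z ∈ W, wronskian (fun j : Fin n => varDeriv (ρ (s.succAbove j))) z ≠ 0 := by
    intro S
    induction S using Finset.induction_on with
    | empty => exact ⟨V, hV, hne, subset_rfl, by simp⟩
    | insert s S _ ih =>
      obtain ⟨W, hW, hWne, hWV, hw⟩ := ih
      obtain ⟨W', hW', hWne', hWW', hw'⟩ := step s.succAbove Fin.succAbove_right_injective W hW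
        hWne (hWV.trans (hVO.trans Set.inter_subset_right))
      refine ⟨W', hW', hWne', hWW'.trans hWV, fun r hr z hz => ?_⟩
      rcases Finset.mem_insert.mp hr with rfl | hr
      · exact hw' z hz
      · exact hw r hr z (hWW' hz)
  obtain ⟨W, -, ⟨y, hy⟩, hWV, hw⟩ := key Finset.univ
  exact ⟨y, (hVO (hWV hy)).1, (hVO (hWV hy)).2, hwV y (hWV hy),
    fun s => hw s (Finset.mem_univ s) y hy⟩

end Density

end EvolutionCL

theorem mainTheorem2 (n r : ℕ) (hr : 2 ≤ r) (U : Set Jet) (hU : IsOpen U)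
    (G : Jet → ℝ) (hG : EvolutionCL.IsDiffFunOfOrderLE r U G)
    (hGr : ∃ z ∈ U, EvolutionCL.partialU r G z ≠ 0)
    (ρ : Fin (n + 1) → Jet → ℝ) (hρ : ∀ s, EvolutionCL.IsDiffFun U (ρ s))
    (lam : Fin (n + 1) → Jet → ℝ) (hlam : ∀ s, lam s = EvolutionCL.varDeriv (ρ s)) :
    (∀ V : Set Jet, IsOpen V → V.Nonempty → V ⊆ EvolutionCL.regularSet U ρ →
      (EvolutionCL.AdmitsLinIndepCL G V ρ ↔
        ∃ H : Jet → ℝ, EvolutionCL.IsDiffFun V H ∧ ∀ z ∈ V,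
          G z = EvolutionCL.darbouxAdjoint lam H z -
            ∑ s : Fin (n + 1), (-1) ^ (n - (s : ℕ)) *
              EvolutionCL.darbouxAdjoint (fun j : Fin n => lam (s.succAbove j))
                (fun w => EvolutionCL.wronskian (fun j : Fin n => lam (s.succAbove j)) w /
                  EvolutionCL.wronskian lam w * EvolutionCL.partialT (ρ s) w) z)) ∧
    ((∀ V : Set Jet, IsOpen V → V.Nonempty → V ⊆ U → EvolutionCL.AdmitsLinIndepCL G V ρ) →
      U ⊆ closure (EvolutionCL.regularSet U ρ)) := by
  obtain rfl : lam = fun s => EvolutionCL.varDeriv (ρ s) := funext hlam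
  have hG' : EvolutionCL.IsDiffFun U G := ⟨r, hG⟩
  refine ⟨fun V hV hne hVU => ?_, EvolutionCL.subset_closure_regularSet hU hG' hρ⟩
  have hVU' : V ⊆ U := fun z hz => (hVU hz).1
  exact EvolutionCL.admitsLinIndepCL_iff hV hne (hG'.mono_set hVU') (fun s => (hρ s).mono_set hVU')
    (fun z hz => (hVU hz).2.1) fun s z hz => (hVU hz).2.2 s
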